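/- **Setting.** Let $A_0$ be a positive-definite self-adjoint operator with compact resolvent in a real Hilbert space $\mathbb H$, with eigenvalues $0<\lambda_1\le\lambda_2\le\dots$ and an associated orthonormal basis of eigenvectors $e_1,e_2,\dots$ of $\mathbb H$, $A_0e_j=\lambda_je_j$. Let $k,N$ be positive integers, $\Lambda,\delta>0$, and put $\alpha=(\lambda_N+\lambda_{N+1})/2$, $\overline\mu=(\lambda_{N+1}-\lambda_N)/2$, $$\mathcal P v=\sum_{j:\ \lambda_j<\lambda_N-k}\langle v,e_j\rangle e_j,\qquad \mathcal Q v=\sum_{j:\ \lambda_j>\lambda_{N+1}+k}\langle v,e_j\rangle e_j,\qquad \mathcal I=\mathrm{Id}-\mathcal P-\mathcal Q .$$ Let $\vartheta$ be a (continuous) semiflow on a complete metric space $\mathsf Q$, and let $a\colon\mathsf Q\to\mathbb R$ be continuous with $\sup_{q}|a(q)|\le\Lambda+\delta$. Assume $$\frac{\overline\mu}{\sqrt5}-\delta\ge0,\qquad k^2-2\Lambda k-4\frac{\Lambda^4}{\overline\mu^2}\ge0,$$ and put $\tau_1=1$, $\tau_2=\frac14(\overline\mu/\Lambda)^2$, $\tau_3=1$.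 Let $\mathbb U=\mathbb H\times\mathbb H$, $\xi=(\xi_I,\xi_c)\in\mathbb U$, $B\xi=\xi_I+\xi_c$, $A(q)=-A_0+(\alpha-a(q))\,\mathrm{Id}$, and $$\mathcal F_q(v,\xi)=\tau_1\big(|\mathcal I\xi_I-a(q)\mathcal Iv|^2-\delta^2|\mathcal Iv|^2\big)+\tau_2\big(|(\mathcal P+\mathcal Q)\xi_I|^2-\Lambda^2|\mathcal Iv|^2\big)+\tau_3\big(|\xi_c|^2-\Lambda^2|(\mathcal P+\mathcal Q)v|^2\big).$$ Write $\mathcal F_q(v,\xi)=\langle F_1(q)v,v\rangle+2\langle F_2(q)v,\xi\rangle+\langle F_3\xi,\xi\rangle$ with $F_1(q)=F_1(q)^*\in\mathcal L(\mathbb H)$, $F_2(q)\in\mathcal L(\mathbb H;\mathbb U)$, $F_3=F_3^*\in\mathcal L(\mathbb U)$, and put $\widehat A(q)=A(q)-BF_3^{-1}F_2(q)$. For $q\in\mathsf Q$ let $\mathbb L^+_b(q)$ be the set of all $z_0=(v_0,\eta_0)\in\mathbb H\times\mathbb H$ for which the Hamiltonian system $$\dot v=\widehat A(\vartheta^t(q))v+BF_3^{-1}B^*\eta,\qquad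 \dot\eta=\big(F_1-F_2^*F_3^{-1}F_2\big)(\vartheta^t(q))\,v-\widehat A^*(\vartheta^t(q))\,\eta$$ has a bounded mild solution $(v,\eta)$ on $[0,\infty)$ with $(v(0),\eta(0))=z_0$. Here solutions are mild in the sense of the Cauchy formula for the semigroup generated by $A=-A_0+\alpha\,\mathrm{Id}$, the bounded terms being treated as inhomogeneities; the formula is used forward in time for $v$ and backward in time for $\eta$. For $v_0\in\mathbb H$ let $\mathfrak M_{v_0}(q)$ be the set of all $(v(\cdot),\xi(\cdot))\in L_2(0,\infty;\mathbb H)\times L_2(0,\infty;\mathbb U)$ such that $v$ is the mild solution of $\dot v(t)=A(\vartheta^t(q))v(t)+B\xi(t)$ with $v(0)=v_0$, and let $$\mathcal J_q(v(\cdot),\xi(\cdot))=\int_0^\infty\mathcal F_{\vartheta^t(q)}(v(t),\xi(t))\,dt .$$ A critical point of $\mathcal J_q$ on $\mathfrak M_0(q)$ is a point of the linear space $\mathfrak M_0(q)$ at which the derivative of $\mathcal J_q$ in every direction from $\mathfrak M_0(q)$ vanishes. **Theorem.** Suppose that for every $q\in\mathsf Q$ the functional $\mathcal J_q$ has a unique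 critical point on $\mathfrak M_0(q)$. Then the Lagrange bundle is nonoscillating: there is a family of bounded self-adjoint operators $P(q)\in\mathcal L(\mathbb H)$, $q\in\mathsf Q$, such that $$\mathbb L^+_b(q)=\{(v,-P(q)v)\ |\ v\in\mathbb H\}\quad\text{for every }q\in\mathsf Q .$$ -/

import Mathlib

open scoped NNReal InnerProductSpace
open MeasureTheory

noncomputable section

namespace SpatialAveraging

/-- `A` has compact resolvent: for some real `z`, the operator `A - z` is a bijection from the
domain of `A` onto `H` whose inverse `R` is a compact operator. -/
def HasCompactResolvent {H : Type*} [NormedAddCommGroup H] [InnerProductSpace ℝ H]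
    (A : H →ₗ.[ℝ] H) : Prop :=
  ∃ (z : ℝ) (R : H →L[ℝ] H), IsCompactOperator R ∧
    (∀ x : H, ∃ hx : R x ∈ A.domain, A ⟨R x, hx⟩ - z • R x = x) ∧
    (∀ x : A.domain, R (A x - z • (x : H)) = x)

/-- `A` is positive-definite: `⟪A x, x⟫ > 0` for every nonzero `x` in the domain. -/
def IsPositiveDefinite {H : Type*} [NormedAddCommGroup H] [InnerProductSpace ℝ H]
    (A : H →ₗ.[ℝ] H) : Prop :=
  ∀ x : A.domain, (x : H) ≠ 0 → 0 < ⟪A x, (x : H)⟫_ℝ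

/-- `e₁, e₂, …` is an orthonormal basis of eigenvectors of `A` with the eigenvalues
`lam 1 ≤ lam 2 ≤ …`. -/
def IsEigenbasis {H : Type*} [NormedAddCommGroup H] [InnerProductSpace ℝ H]
    (A : H →ₗ.[ℝ] H) (e : HilbertBasis ℕ+ ℝ H) (lam : ℕ+ → ℝ) : Prop :=
  Monotone lam ∧ ∀ j : ℕ+, ∃ hj : e j ∈ A.domain, A ⟨e j, hj⟩ = lam j • e j

/-- The orthogonal projector onto the closed linear span of the `e j` with `j ∈ S`. -/
def modeProj {H : Type*} [NormedAddCommGroup H] [InnerProductSpace ℝ H] [CompleteSpace H]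
    (e : HilbertBasis ℕ+ ℝ H) (S : Set ℕ+) : H →L[ℝ] H :=
  (Submodule.span ℝ (e '' S)).topologicalClosure.starProjection

theorem modeProj_basis_mem {H : Type*} [NormedAddCommGroup H] [InnerProductSpace ℝ H]
    [CompleteSpace H] (e : HilbertBasis ℕ+ ℝ H) (S : Set ℕ+) {j : ℕ+} (hj : j ∈ S) :
    modeProj e S (e j) = e j := by
  rw [modeProj, Submodule.starProjection_eq_self_iff]
  exact Submodule.le_topologicalClosure _ (Submodule.subset_span ⟨j, hj, rfl⟩)

theorem modeProj_basis_notMem {H : Type*} [NormedAddCommGroup H] [InnerProductSpace ℝ H]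
    [CompleteSpace H] (e : HilbertBasis ℕ+ ℝ H) (S : Set ℕ+) {j : ℕ+} (hj : j ∉ S) :
    modeProj e S (e j) = 0 := by
  rw [modeProj, Submodule.starProjection_apply_eq_zero_iff, Submodule.orthogonal_closure,
    Submodule.mem_orthogonal]
  intro u hu
  induction hu using Submodule.span_induction with
  | mem x hx =>
    obtain ⟨i, hi, rfl⟩ := hx
    exact e.orthonormal.2 (fun h => hj (h ▸ hi))
  | zero => simp
  | add x y _ _ hx hy => rw [inner_add_left, hx, hy, add_zero]
  | smul c x _ hx => rw [inner_smul_left, hx, mul_zero]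

/-- The projector is `v ↦ ∑_{j ∈ S} ⟪v, e_j⟫ e_j`. -/
theorem hasSum_modeProj {H : Type*} [NormedAddCommGroup H] [InnerProductSpace ℝ H]
    [CompleteSpace H] (e : HilbertBasis ℕ+ ℝ H) (S : Set ℕ+) (v : H) :
    HasSum (S.indicator fun j => ⟪v, e j⟫_ℝ • e j) (modeProj e S v) := by
  have h := (modeProj e S).hasSum (e.hasSum_repr v)
  convert h using 2 with j
  simp only [map_smul, e.repr_apply_apply]
  by_cases hj : j ∈ S
  · rw [Set.indicator_of_mem hj, modeProj_basis_mem e S hj, real_inner_comm]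
  · rw [Set.indicator_of_notMem hj, modeProj_basis_notMem e S hj, smul_zero]

/-- The control space `H × H` with the Hilbert space inner product; its elements are
`ξ = (ξ_I, ξ_c)` with `ξ_I = ξ.fst` and `ξ_c = ξ.snd`. -/
abbrev ControlSpace (H : Type*) : Type _ := WithLp 2 (H × H)

/-- The numbers, functions and bases from which the Hamiltonian system and the quadratic
functional are built. (This is raw data, all assumptions on it are made where it is used.) -/
structure Setting (H Q : Type*) [NormedAddCommGroup H] [InnerProductSpace ℝ H]
    [CompleteSpace H] [MetricSpace Q] where
  /-- the orthonormal basis of eigenvectors -/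
  e : HilbertBasis ℕ+ ℝ H
  /-- the eigenvalues -/
  lam : ℕ+ → ℝ
  k : ℕ+
  N : ℕ+
  Lam : ℝ
  δ : ℝ
  τ₁ : ℝ
  τ₂ : ℝ
  τ₃ : ℝ
  /-- the semiflow on the base space -/
  θ : Flow ℝ≥0 Q
  a : Q → ℝ

namespace Setting

variable {H Q : Type*} [NormedAddCommGroup H] [InnerProductSpace ℝ H] [CompleteSpace H]
  [MetricSpace Q] (S : Setting H Q)

/-- `α = (λ_N + λ_{N+1}) / 2`. -/
def α : ℝ := (S.lam S.N + S.lam (S.N + 1)) / 2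

/-- Half of the spectral gap, `(λ_{N+1} - λ_N) / 2`. -/
def μ : ℝ := (S.lam (S.N + 1) - S.lam S.N) / 2

/-- The point `ϑ^t(q)` for `t ≥ 0`. -/
def shift (t : ℝ) (q : Q) : Q := S.θ t.toNNReal q

/-! ### Spectral projectors -/

/-- The projector on essentially lower modes, `λ_j < λ_N - k`. -/
def lowProj : H →L[ℝ] H := modeProj S.e {j | S.lam j < S.lam S.N - (S.k : ℕ)}

/-- The projector on essentially higher modes, `λ_j > λ_{N+1} + k`. -/
def highProj : H →L[ℝ] H := modeProj S.e {j | S.lam (S.N + 1) + (S.k : ℕ) < S.lam j}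

/-- The projector on intermediate modes. -/
def midProj : H →L[ℝ] H := ContinuousLinearMap.id ℝ H - S.lowProj - S.highProj

/-! ### The quadratic forms and the operators that define them -/

def form₁ (q : Q) (v : H) (ξ : ControlSpace H) : ℝ :=
  ‖S.midProj ξ.fst - S.a q • S.midProj v‖ ^ 2 - S.δ ^ 2 * ‖S.midProj v‖ ^ 2

def form₂ (v : H) (ξ : ControlSpace H) : ℝ :=
  ‖(S.lowProj + S.highProj) ξ.fst‖ ^ 2 - S.Lam ^ 2 * ‖S.midProj v‖ ^ 2

def form₃ (v : H) (ξ : ControlSpace H) : ℝ :=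
  ‖ξ.snd‖ ^ 2 - S.Lam ^ 2 * ‖(S.lowProj + S.highProj) v‖ ^ 2

/-- The quadratic form `F_q(v, ξ)`. -/
def form (q : Q) (v : H) (ξ : ControlSpace H) : ℝ :=
  S.τ₁ * S.form₁ q v ξ + S.τ₂ * S.form₂ v ξ + S.τ₃ * S.form₃ v ξ

def F₁ (q : Q) : H →L[ℝ] H :=
  (S.τ₁ * |S.a q| ^ 2) • S.midProj - (S.τ₁ * S.δ ^ 2) • S.midProj
    - (S.τ₂ * S.Lam ^ 2) • S.midProj - (S.τ₃ * S.Lam ^ 2) • (S.lowProj + S.highProj)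

def F₂ (q : Q) : H →L[ℝ] ControlSpace H :=
  (WithLp.prodContinuousLinearEquiv 2 ℝ H H).symm.toContinuousLinearMap ∘L
    ((-(S.τ₁ * S.a q)) • S.midProj).prod 0

def F₃ : ControlSpace H →L[ℝ] ControlSpace H :=
  (WithLp.prodContinuousLinearEquiv 2 ℝ H H).symm.toContinuousLinearMap ∘L
    ((S.τ₁ • S.midProj + S.τ₂ • (S.lowProj + S.highProj)) ∘L WithLp.fstL 2 ℝ H H).prod
      (S.τ₃ • WithLp.sndL 2 ℝ H H)

/-- The inverse of `F₃` (which is invertible whenever `τ₁, τ₂, τ₃` are nonzero). -/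
def F₃inv : ControlSpace H →L[ℝ] ControlSpace H := S.F₃.inverse

/-- The control operator `B (ξ_I, ξ_c) = ξ_I + ξ_c`. -/
def B (_S : Setting H Q) : ControlSpace H →L[ℝ] H :=
  WithLp.fstL 2 ℝ H H + WithLp.sndL 2 ℝ H H

/-! ### The Hamiltonian system

Put `A = -A₀ + α`, `A(q) = A - a(q)` and `Â(q) = A(q) - B F₃⁻¹ F₂(q)`. The Hamiltonian system
`v' = Â v + B F₃⁻¹ B* η`, `η' = (F₁ - F₂* F₃⁻¹ F₂) v - Â* η` (coefficients at `ϑ^t(q)`) is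
the system `v' = A v + R₁₁ v + R₁₂ η`, `η' = -A η + R₂₁ v + R₂₂ η` with bounded `Rᵢⱼ`. -/

def R₁₁ (q : Q) : H →L[ℝ] H :=
  -(S.B ∘L S.F₃inv ∘L S.F₂ q) - S.a q • ContinuousLinearMap.id ℝ H

def R₁₂ : H →L[ℝ] H := S.B ∘L S.F₃inv ∘L S.B.adjoint

def R₂₁ (q : Q) : H →L[ℝ] H := S.F₁ q - (S.F₂ q).adjoint ∘L S.F₃inv ∘L S.F₂ q

def R₂₂ (q : Q) : H →L[ℝ] H :=
  (S.B ∘L S.F₃inv ∘L S.F₂ q).adjoint + S.a q • ContinuousLinearMap.id ℝ H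

/-- The `C₀`-semigroup `G(t) = exp(t A)`, `t ≥ 0`, generated by the self-adjoint operator
`A = -A₀ + α`, given by its expansion over the eigenbasis of `A₀`. -/
def G (t : ℝ) (v : H) : H :=
  ∑' j : ℕ+, Real.exp ((S.α - S.lam j) * t) • ⟪S.e j, v⟫_ℝ • S.e j

/-- `(v, η)` is a mild solution on `[0, ∞)` of the Hamiltonian system over `q`. The equation for
`v` is understood through the Cauchy formula. Since `-A` generates a semigroup in backward time
only, the equation for `η` is understood through the Cauchy formula in backward time. -/
def IsMildSolution (q : Q) (v η : ℝ → H) : Prop :=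
  ContinuousOn v (Set.Ici 0) ∧ ContinuousOn η (Set.Ici 0) ∧
  (∀ t : ℝ, 0 ≤ t → v t = S.G t (v 0) +
    ∫ s in (0 : ℝ)..t, S.G (t - s) (S.R₁₁ (S.shift s q) (v s) + S.R₁₂ (η s))) ∧
  (∀ s t : ℝ, 0 ≤ s → s ≤ t → η s = S.G (t - s) (η t) -
    ∫ r in s..t, S.G (r - s) (S.R₂₁ (S.shift r q) (v r) + S.R₂₂ (S.shift r q) (η r)))

/-- The fiber `L⁺_b(q)` of the stable Lagrange bundle: the initial data of the bounded mild
solutions of the Hamiltonian system on `[0, ∞)`. -/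
def stableFiber (q : Q) : Set (H × H) :=
  {z₀ | ∃ v η : ℝ → H, S.IsMildSolution q v η ∧ (v 0, η 0) = z₀ ∧
    ∃ C : ℝ, ∀ t : ℝ, 0 ≤ t → ‖v t‖ ≤ C ∧ ‖η t‖ ≤ C}

/-- The system is nonoscillating: every fiber is a graph `{(v, -P(q) v)}` with a bounded
self-adjoint operator `P(q)`. -/
def IsNonoscillating : Prop :=
  ∃ P : Q → H →L[ℝ] H, (∀ q, IsSelfAdjoint (P q)) ∧
    ∀ q, S.stableFiber q = {z | ∃ v : H, z = (v, -(P q v))}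

/-! ### Processes and the integral quadratic functional -/

/-- Pairs `(v(·), ξ(·))` in `L₂(0, ∞; H) × L₂(0, ∞; H × H)`. -/
abbrev PairSpace (H : Type*) [NormedAddCommGroup H] : Type _ :=
  Lp H 2 (volume.restrict (Set.Ioi (0 : ℝ))) ×
    Lp (ControlSpace H) 2 (volume.restrict (Set.Ioi (0 : ℝ)))

/-- The set of processes through `v₀` over `q`: square-integrable pairs such that `v(·)` is the
mild solution of `v' = A(ϑ^t(q)) v + B ξ = A v - a(ϑ^t(q)) v + B ξ`, `v(0) = v₀`. -/
def processes (q : Q) (v₀ : H) : Set (PairSpace H) :=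
  {p | ∀ᵐ t ∂(volume.restrict (Set.Ioi (0 : ℝ))), p.1 t = S.G t v₀ +
    ∫ s in (0 : ℝ)..t, S.G (t - s) (-(S.a (S.shift s q) • p.1 s) + S.B (p.2 s))}

/-- The integral quadratic functional `J_q`. -/
def functional (q : Q) (p : PairSpace H) : ℝ :=
  ∫ t in Set.Ioi (0 : ℝ), S.form (S.shift t q) (p.1 t) (p.2 t)

/-- `p` is a critical point of `J_q` on the linear space of processes through `0`: it belongs to
that space and the derivative of `J_q` at `p` vanishes in all directions of the space. -/
def IsCriticalPoint (q : Q) (p : PairSpace H) : Prop :=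
  p ∈ S.processes q 0 ∧ ∀ h ∈ S.processes q 0,
    HasDerivAt (fun s : ℝ => S.functional q (p + s • h)) 0 0

end Setting

end SpatialAveraging

end

/-! Every operator in the Hamiltonian system is diagonal in the eigenbasis, and `a` enters as a
scalar, so the system splits into independent planar systems v' = b v + c η, η' = -d v - b η with
constants c, d > 0 (`isMildSolution_iff`). On intermediate modes the feedback through `F₂` cancels
`a`, so b = α - λ_j; on the other modes b = α - λ_j - a. The gap condition handles the intermediate
modes and the condition on k the others: in both cases b has constant sign and |b| exceeds √(cd) by
a margin independent of the mode.

With r = √(c/d), the variables v ± rη turn such a system into a saddle y' = f z, z' = g y with f, g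
≥ m > 0. There (yz)' = f z² + g y² ≥ m(y² + z²), so a bounded solution must keep yz ≤ 0, while a
compactness argument on the unit sphere of initial data yields a nonzero solution with yz ≤ 0
forever (`exists_mul_nonpos`). In the region yz ≤ 0 both y² and z² decrease, and v(0) controls the
whole solution. Hence each mode has exactly one bounded solution (φ_j, ψ_j) with φ_j(0) = 1, bounded
by a constant C that does not depend on j, b or q (`exists_uniform_bound_isModeSolution`,
`exists_uniform_mode_bound`).

Uniformity in j lets the modes be summed: the diagonal operator P(q) with entries -ψ_j(0) is bounded
and self-adjoint. Its graph is the fiber, since the solutions ⟨e_j, x⟩(φ_j, ψ_j) assemble into a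
bounded mild solution through x, and uniqueness in each mode forces every bounded mild solution to
arise in this way. -/

/-! ### Linear differential equations -/

section LinearODE

variable {E : Type*} [NormedAddCommGroup E] [NormedSpace ℝ E]

/-- The terms of the Peano–Baker series for `x' = A(t) x`, `x 0 = x₀`. -/
noncomputable def peanoBaker (A : ℝ → E →L[ℝ] E) (x₀ : E) : ℕ → ℝ → E
  | 0 => fun _ => x₀
  | n + 1 => fun t => ∫ s in (0 : ℝ)..t, A s (peanoBaker A x₀ n s)

theorem continuous_peanoBaker {A : ℝ → E →L[ℝ] E} (hA : Continuous A) (x₀ : E) (n : ℕ) :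
    Continuous (peanoBaker A x₀ n) := by
  induction n with
  | zero => exact continuous_const
  | succ n ih =>
    exact intervalIntegral.continuous_primitive
      (fun a b => (hA.clm_apply ih).intervalIntegrable a b) 0

theorem hasDerivAt_peanoBaker_succ [CompleteSpace E] {A : ℝ → E →L[ℝ] E} (hA : Continuous A)
    (x₀ : E) (n : ℕ) (t : ℝ) :
    HasDerivAt (peanoBaker A x₀ (n + 1)) (A t (peanoBaker A x₀ n t)) t :=
  (hA.clm_apply (continuous_peanoBaker hA x₀ n)).integral_hasStrictDerivAt 0 t |>.hasDerivAt

/-- Each iterated integration gains a factor K|t|/(n+1), so the series is dominated by an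
exponential series on bounded time intervals. Absolute values of t cover both directions of time. -/
theorem norm_peanoBaker_le {A : ℝ → E →L[ℝ] E} (x₀ : E) {K T : ℝ}
    (hK : ∀ t, |t| ≤ T → ‖A t‖ ≤ K) (n : ℕ) (t : ℝ) (ht : |t| ≤ T) :
    ‖peanoBaker A x₀ n t‖ ≤ ‖x₀‖ * ((K * |t|) ^ n / n.factorial) := by
  have hK0 : 0 ≤ K := (norm_nonneg _).trans (hK t ht)
  induction n generalizing t with
  | zero => simp [peanoBaker]
  | succ n ih =>
    have hb : ∀ s ∈ Set.uIoc 0 t,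
        ‖A s (peanoBaker A x₀ n s)‖ ≤ ‖x₀‖ * K ^ (n + 1) / n.factorial * |s - 0| ^ n := by
      intro s hs
      have hs' : |s| ≤ T := by
        rcases Set.mem_uIoc.1 hs with h | h
        · rw [abs_of_nonneg h.1.le]; exact h.2.trans ((le_abs_self t).trans ht)
        · rw [abs_of_nonpos h.2]; exact (neg_le_neg h.1.le).trans ((neg_le_abs t).trans ht)
      calc ‖A s (peanoBaker A x₀ n s)‖ ≤ ‖A s‖ * ‖peanoBaker A x₀ n s‖ := (A s).le_opNorm _
        _ ≤ K * (‖x₀‖ * ((K * |s|) ^ n / n.factorial)) := by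
          gcongr
          · exact hK s hs'
          · exact ih s hs'
        _ = _ := by rw [sub_zero, mul_pow]; ring
    rw [peanoBaker, intervalIntegral.norm_integral_eq_norm_integral_uIoc]
    refine (norm_integral_le_of_norm_le (μ := volume.restrict (Set.uIoc 0 t)) ?_
      ((ae_restrict_iff' measurableSet_uIoc).2 (.of_forall hb))).trans ?_
    · exact ((by fun_prop : Continuous fun s : ℝ =>
        ‖x₀‖ * K ^ (n + 1) / n.factorial * |s - 0| ^ n).intervalIntegrable 0 t).def'
    · rw [integral_const_mul, integral_pow_abs_sub_uIoc, sub_zero, Nat.factorial_succ,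
        Nat.cast_mul, mul_pow]
      apply le_of_eq
      push_cast
      field_simp

/-- Global solvability of the linear Cauchy problem. -/
theorem exists_linearODE_solution [CompleteSpace E] {A : ℝ → E →L[ℝ] E} (hA : Continuous A)
    (x₀ : E) : ∃ x : ℝ → E, x 0 = x₀ ∧ ∀ t, HasDerivAt x (A t (x t)) t := by
  have hzero : ∀ n, peanoBaker A x₀ (n + 1) 0 = 0 := fun n => by simp [peanoBaker]
  have hbound : ∀ T : ℝ, ∃ K : ℝ, ∀ t, |t| ≤ T → ‖A t‖ ≤ K := by
    intro T
    obtain ⟨K, hK⟩ := (isCompact_Icc (a := -T) (b := T)).exists_bound_of_continuousOn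
      hA.continuousOn
    exact ⟨K, fun t ht => hK t (abs_le.1 ht)⟩
  have hsum : ∀ t, Summable fun n => peanoBaker A x₀ n t := by
    intro t
    obtain ⟨K, hK⟩ := hbound |t|
    exact .of_norm_bounded ((Real.summable_pow_div_factorial (K * |t|)).mul_left ‖x₀‖)
      fun n => norm_peanoBaker_le x₀ hK n t le_rfl
  -- The constant term is split off because the derivative of term n + 1 is A applied to term n; the
  -- differentiated series is then A applied to the full sum.
  refine ⟨fun t => x₀ + ∑' n, peanoBaker A x₀ (n + 1) t, by simp [hzero], fun t => ?_⟩
  obtain ⟨K, hK⟩ := hbound (|t| + 1)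
  have hmem : ∀ s ∈ Metric.ball (0 : ℝ) (|t| + 1), |s| ≤ |t| + 1 := fun s hs => by
    simpa using (Metric.mem_ball.1 hs).le
  have hK0 : 0 ≤ K := (norm_nonneg _).trans (hK 0 (by simp; positivity))
  have hd := hasDerivAt_tsum_of_isPreconnected (𝕜 := ℝ)
    (g := fun n => peanoBaker A x₀ (n + 1)) (g' := fun n s => A s (peanoBaker A x₀ n s))
    (t := Metric.ball (0 : ℝ) (|t| + 1)) (y₀ := 0) (y := t)
    (u := fun n => K * (‖x₀‖ * ((K * (|t| + 1)) ^ n / n.factorial)))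
    (((Real.summable_pow_div_factorial _).mul_left _).mul_left _)
    Metric.isOpen_ball (convex_ball _ _).isPreconnected
    (fun n s _ => hasDerivAt_peanoBaker_succ hA x₀ n s)
    (fun n s hs => (A s).le_opNorm _ |>.trans (by
      gcongr
      · exact hK s (hmem s hs)
      · refine (norm_peanoBaker_le x₀ hK n s (hmem s hs)).trans ?_
        gcongr
        exact hmem s hs))
    (Metric.mem_ball_self (by positivity)) (by simp [hzero])
    (by simp)
  convert hd.const_add x₀ using 1
  rw [← (A t).map_tsum (hsum t), (hsum t).tsum_eq_zero_add]
  rfl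

end LinearODE

/-! ### Planar saddles -/

/-- `y' = f z`, `z' = g y` on `[0, ∞)`. -/
structure IsSaddleSolution (f g y z : ℝ → ℝ) : Prop where
  continuousOn_fst : ContinuousOn y (Set.Ici 0)
  continuousOn_snd : ContinuousOn z (Set.Ici 0)
  deriv_fst : ∀ t, 0 < t → HasDerivAt y (f t * z t) t
  deriv_snd : ∀ t, 0 < t → HasDerivAt z (g t * y t) t

theorem monotoneOn_Ici_of_hasDerivAt {h h' : ℝ → ℝ} (hc : ContinuousOn h (Set.Ici 0))
    (hd : ∀ t, 0 < t → HasDerivAt h (h' t) t) (hn : ∀ t, 0 < t → 0 ≤ h' t) :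
    MonotoneOn h (Set.Ici 0) := by
  refine monotoneOn_of_deriv_nonneg (convex_Ici 0) hc ?_ ?_
  · intro t ht
    rw [interior_Ici] at ht
    exact (hd t ht).differentiableAt.differentiableWithinAt
  · intro t ht
    rw [interior_Ici] at ht
    rw [(hd t ht).deriv]
    exact hn t ht

namespace IsSaddleSolution

variable {f g y z : ℝ → ℝ} {m : ℝ}

theorem deriv_mul (h : IsSaddleSolution f g y z) (t : ℝ) (ht : 0 < t) :
    HasDerivAt (fun s => y s * z s) (f t * z t ^ 2 + g t * y t ^ 2) t :=
  ((h.deriv_fst t ht).mul (h.deriv_snd t ht)).congr_deriv (by ring)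

theorem deriv_sq_fst (h : IsSaddleSolution f g y z) (t : ℝ) (ht : 0 < t) :
    HasDerivAt (fun s => y s ^ 2) (2 * f t * (y t * z t)) t :=
  ((h.deriv_fst t ht).pow 2).congr_deriv (by simp only [Nat.cast_ofNat]; ring)

theorem symm (h : IsSaddleSolution f g y z) : IsSaddleSolution g f z y :=
  ⟨h.2, h.1, h.4, h.3⟩

theorem monotoneOn_mul (h : IsSaddleSolution f g y z) (hf : ∀ t, 0 ≤ t → 0 ≤ f t)
    (hg : ∀ t, 0 ≤ t → 0 ≤ g t) : MonotoneOn (fun s => y s * z s) (Set.Ici 0) :=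
  monotoneOn_Ici_of_hasDerivAt (h.1.mul h.2) h.deriv_mul fun t ht => by
    have := hf t ht.le
    have := hg t ht.le
    positivity

/-- If `y²+z² ≥ ε > 0` from some time on, then `yz` is unbounded. -/
theorem exists_lt_mul (h : IsSaddleSolution f g y z) (hm : 0 < m) (hf : ∀ t, 0 ≤ t → m ≤ f t)
    (hg : ∀ t, 0 ≤ t → m ≤ g t) {ε t₀ : ℝ} (hε : 0 < ε) (ht₀ : 0 ≤ t₀)
    (hlow : ∀ t, t₀ ≤ t → ε ≤ y t ^ 2 + z t ^ 2) (K : ℝ) :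
    ∃ t, t₀ ≤ t ∧ K < y t * z t := by
  have hmono : MonotoneOn (fun s => y s * z s - m * ε * s) (Set.Ici t₀) := by
    have hd : ∀ t, t₀ < t → HasDerivAt (fun s => y s * z s - m * ε * s)
        (f t * z t ^ 2 + g t * y t ^ 2 - m * ε * 1) t := fun t ht =>
      (h.deriv_mul t (ht₀.trans_lt ht)).sub ((hasDerivAt_id t).const_mul (m * ε))
    refine monotoneOn_of_deriv_nonneg (convex_Ici _) ?_ ?_ ?_
    · exact ((h.1.mul h.2).mono (Set.Ici_subset_Ici.2 ht₀)).sub (by fun_prop)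
    · intro t ht
      rw [interior_Ici] at ht
      exact (hd t ht).differentiableAt.differentiableWithinAt
    · intro t ht
      rw [interior_Ici] at ht
      rw [(hd t ht).deriv]
      have h1 := mul_le_mul_of_nonneg_right (hf t (ht₀.trans ht.le)) (sq_nonneg (z t))
      have h2 := mul_le_mul_of_nonneg_right (hg t (ht₀.trans ht.le)) (sq_nonneg (y t))
      have h3 := mul_le_mul_of_nonneg_left (hlow t ht.le) hm.le
      linarith
  have hmε : 0 < m * ε := mul_pos hm hε
  set D := |K - y t₀ * z t₀| + 1 with hD
  have hD0 : 0 < D := by positivity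
  have ht : t₀ ≤ t₀ + D / (m * ε) := by
    have := div_pos hD0 hmε
    linarith
  refine ⟨t₀ + D / (m * ε), ht, ?_⟩
  have h1 := hmono Set.self_mem_Ici ht ht
  have h2 : m * ε * (t₀ + D / (m * ε)) = m * ε * t₀ + D := by field_simp
  simp only [h2] at h1
  have h3 := le_abs_self (K - y t₀ * z t₀)
  linarith

/-- Once yz is positive it stays at least as large, so y² + z² ≥ 2yz is bounded away from zero and
yz grows without bound. -/
theorem mul_nonpos_of_bounded (h : IsSaddleSolution f g y z) (hm : 0 < m)
    (hf : ∀ t, 0 ≤ t → m ≤ f t) (hg : ∀ t, 0 ≤ t → m ≤ g t) {K : ℝ}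
    (hK : ∀ t, 0 ≤ t → y t * z t ≤ K) (t : ℝ) (ht : 0 ≤ t) : y t * z t ≤ 0 := by
  by_contra! hpos
  obtain ⟨s, hs, hlt⟩ := h.exists_lt_mul hm hf hg (mul_pos two_pos hpos) ht (fun s hs => by
    have h1 : y t * z t ≤ y s * z s :=
      h.monotoneOn_mul (fun t ht => hm.le.trans (hf t ht)) (fun t ht => hm.le.trans (hg t ht))
        ht (ht.trans hs) hs
    nlinarith [sq_nonneg (y s - z s)]) K
  exact (hK s (ht.trans hs)).not_gt hlt

theorem sq_fst_le (h : IsSaddleSolution f g y z) (hf : ∀ t, 0 ≤ t → 0 ≤ f t)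
    (hyz : ∀ t, 0 ≤ t → y t * z t ≤ 0) (t : ℝ) (ht : 0 ≤ t) : y t ^ 2 ≤ y 0 ^ 2 := by
  have := monotoneOn_Ici_of_hasDerivAt (h.1.pow 2).neg (fun t ht => (h.deriv_sq_fst t ht).neg)
    (fun t ht => by nlinarith [mul_nonpos_of_nonneg_of_nonpos (hf t ht.le) (hyz t ht.le)])
    (Set.self_mem_Ici) ht ht
  simpa using this

/-- When yz ≤ 0, the derivative 2(f - ϑg)yz of y² - ϑz² is nonnegative. A positive initial value
would therefore keep y² bounded below and drive yz to positive values. -/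
theorem sq_fst_le_mul_sq_snd (h : IsSaddleSolution f g y z) (hm : 0 < m)
    (hf : ∀ t, 0 ≤ t → m ≤ f t) (hg : ∀ t, 0 ≤ t → m ≤ g t)
    (hyz : ∀ t, 0 ≤ t → y t * z t ≤ 0) {ϑ : ℝ} (hϑ : 0 ≤ ϑ)
    (hfg : ∀ t, 0 ≤ t → f t ≤ ϑ * g t) : y 0 ^ 2 ≤ ϑ * z 0 ^ 2 := by
  by_contra! hlt
  have hmono : MonotoneOn (fun s => y s ^ 2 - ϑ * z s ^ 2) (Set.Ici 0) :=
    monotoneOn_Ici_of_hasDerivAt ((h.1.pow 2).sub (continuousOn_const.mul (h.2.pow 2)))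
      (fun t ht => (h.deriv_sq_fst t ht).sub ((h.symm.deriv_sq_fst t ht).const_mul ϑ))
      (fun t ht => by
        nlinarith [mul_nonneg (sub_nonneg.2 (hfg t ht.le)) (neg_nonneg.2 (hyz t ht.le))])
  obtain ⟨t, ht, hlt'⟩ := h.exists_lt_mul hm hf hg (sub_pos.2 hlt) le_rfl (fun t ht => by
    have h1 : y 0 ^ 2 - ϑ * z 0 ^ 2 ≤ y t ^ 2 - ϑ * z t ^ 2 := hmono Set.self_mem_Ici ht ht
    nlinarith [mul_nonneg hϑ (sq_nonneg (z t)), sq_nonneg (z t)]) 0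
  exact (hyz t ht).not_gt hlt'

/-- A saddle has a nonzero solution that does not leave the stable quadrants. -/
theorem exists_mul_nonpos (hfc : Continuous f) (hgc : Continuous g)
    (hf : ∀ t, 0 ≤ t → 0 ≤ f t) (hg : ∀ t, 0 ≤ t → 0 ≤ g t) :
    ∃ y z : ℝ → ℝ, IsSaddleSolution f g y z ∧ (y 0, z 0) ≠ 0 ∧
      ∀ t, 0 ≤ t → y t * z t ≤ 0 := by
  let A : ℝ → (ℝ × ℝ) →L[ℝ] (ℝ × ℝ) := fun t =>
    f t • (ContinuousLinearMap.inl ℝ ℝ ℝ ∘L ContinuousLinearMap.snd ℝ ℝ ℝ) +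
      g t • (ContinuousLinearMap.inr ℝ ℝ ℝ ∘L ContinuousLinearMap.fst ℝ ℝ ℝ)
  have hA : Continuous A := by fun_prop
  have hAt : ∀ t x, A t x = (f t * x.2, g t * x.1) := fun t x => by simp [A]
  obtain ⟨x₁, hx₁, hd₁⟩ := exists_linearODE_solution hA (1, 0)
  obtain ⟨x₂, hx₂, hd₂⟩ := exists_linearODE_solution hA (0, 1)
  let y : ℝ × ℝ → ℝ → ℝ := fun p t => p.1 * (x₁ t).1 + p.2 * (x₂ t).1
  let z : ℝ × ℝ → ℝ → ℝ := fun p t => p.1 * (x₁ t).2 + p.2 * (x₂ t).2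
  have hy : ∀ p t, HasDerivAt (y p) (f t * z p t) t := fun p t => by
    have h1 : HasDerivAt (fun t => (x₁ t).1) _ t := (hd₁ t).fst
    have h2 : HasDerivAt (fun t => (x₂ t).1) _ t := (hd₂ t).fst
    refine ((h1.const_mul p.1).add (h2.const_mul p.2)).congr_deriv ?_
    simp only [z, hAt]; ring
  have hz : ∀ p t, HasDerivAt (z p) (g t * y p t) t := fun p t => by
    have h1 : HasDerivAt (fun t => (x₁ t).2) _ t := (hd₁ t).snd
    have h2 : HasDerivAt (fun t => (x₂ t).2) _ t := (hd₂ t).snd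
    refine ((h1.const_mul p.1).add (h2.const_mul p.2)).congr_deriv ?_
    simp only [y, hAt]; ring
  have hsol : ∀ p, IsSaddleSolution f g (y p) (z p) := fun p =>
    ⟨fun t _ => (hy p t).continuousAt.continuousWithinAt,
      fun t _ => (hz p t).continuousAt.continuousWithinAt, fun t _ => hy p t, fun t _ => hz p t⟩
  -- Unit initial data that are still in the stable quadrants at time n. Monotonicity of yz makes
  -- these compact sets nested, and a point of their intersection stays there for all time.
  let C : ℕ → Set (ℝ × ℝ) := fun n => Metric.sphere 0 1 ∩ {p | y p n * z p n ≤ 0}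
  have hclosed : ∀ n : ℕ, IsClosed {p : ℝ × ℝ | y p n * z p n ≤ 0} := fun n =>
    isClosed_le (by fun_prop) continuous_const
  have hmono : ∀ p, MonotoneOn (fun s => y p s * z p s) (Set.Ici 0) := fun p =>
    (hsol p).monotoneOn_mul hf hg
  obtain ⟨p, hp⟩ : (⋂ n, C n).Nonempty := by
    refine IsCompact.nonempty_iInter_of_sequence_nonempty_isCompact_isClosed C ?_ ?_
      ((isCompact_sphere _ _).inter_right (hclosed 0))
      fun n => Metric.isClosed_sphere.inter (hclosed n)
    · rintro n p ⟨hp1, hp2⟩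
      refine ⟨hp1, (hmono p (Set.mem_Ici.2 n.cast_nonneg) (Set.mem_Ici.2 (n + 1).cast_nonneg)
        (Nat.cast_le.2 n.le_succ)).trans hp2⟩
    · intro n
      -- One linear equation in two unknowns always has a nonzero solution, and z = 0 gives yz = 0.
      have hex : ∃ p : ℝ × ℝ, p ≠ 0 ∧ z p n = 0 := by
        by_cases h0 : ((x₂ n).2, -(x₁ n).2) = (0 : ℝ × ℝ)
        · simp only [Prod.mk_eq_zero, neg_eq_zero] at h0
          exact ⟨(1, 0), by simp, by simp [z, h0.1, h0.2]⟩
        · exact ⟨_, h0, by simp only [z]; ring⟩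
      obtain ⟨p, hp0, hp⟩ := hex
      refine ⟨‖p‖⁻¹ • p, by simp [norm_smul, hp0], ?_⟩
      have : z (‖p‖⁻¹ • p) n = ‖p‖⁻¹ * z p n := by simp [z]; ring
      simp [this, hp]
  simp only [Set.mem_iInter] at hp
  refine ⟨y p, z p, hsol p, ?_, fun t ht => ?_⟩
  · have hp1 : ‖p‖ = 1 := by simpa using (hp 0).1
    intro h0
    have : p = 0 := by simpa [y, z, hx₁, hx₂] using h0
    simp [this] at hp1
  · obtain ⟨n, hn⟩ := exists_nat_ge t
    exact (hmono p ht (ht.trans hn) hn).trans (hp n).2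

end IsSaddleSolution

/-! ### Scalar Hamiltonian equations and their reduction to saddles -/

/-- `v' = b v + c η`, `η' = -d v - b η` on `[0, ∞)`. -/
structure IsModeSolution (b : ℝ → ℝ) (c d : ℝ) (v η : ℝ → ℝ) : Prop where
  continuousOn_fst : ContinuousOn v (Set.Ici 0)
  continuousOn_snd : ContinuousOn η (Set.Ici 0)
  deriv_fst : ∀ t, 0 < t → HasDerivAt v (b t * v t + c * η t) t
  deriv_snd : ∀ t, 0 < t → HasDerivAt η (-d * v t - b t * η t) t

namespace IsModeSolution

variable {b v η : ℝ → ℝ} {c d r : ℝ}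

theorem const_mul (h : IsModeSolution b c d v η) (a : ℝ) :
    IsModeSolution b c d (fun t => a * v t) (fun t => a * η t) :=
  ⟨continuousOn_const.mul h.1, continuousOn_const.mul h.2,
    fun t ht => ((h.deriv_fst t ht).const_mul a).congr_deriv (by ring),
    fun t ht => ((h.deriv_snd t ht).const_mul a).congr_deriv (by ring)⟩

theorem isSaddleSolution_of_pos (h : IsModeSolution b (d * r ^ 2) d v η) :
    IsSaddleSolution (fun t => b t - d * r) (fun t => b t + d * r)
      (fun t => v t + r * η t) (fun t => v t - r * η t) :=
  ⟨h.1.add (continuousOn_const.mul h.2), h.1.sub (continuousOn_const.mul h.2),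
    fun t ht => ((h.deriv_fst t ht).add ((h.deriv_snd t ht).const_mul r)).congr_deriv (by ring),
    fun t ht => ((h.deriv_fst t ht).sub ((h.deriv_snd t ht).const_mul r)).congr_deriv (by ring)⟩

/-- For negative b the second variable changes sign, so that both saddle coefficients become
positive. -/
theorem isSaddleSolution_of_neg (h : IsModeSolution b (d * r ^ 2) d v η) :
    IsSaddleSolution (fun t => -b t + d * r) (fun t => -b t - d * r)
      (fun t => v t + r * η t) (fun t => r * η t - v t) :=
  ⟨h.1.add (continuousOn_const.mul h.2), (continuousOn_const.mul h.2).sub h.1,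
    fun t ht => ((h.deriv_fst t ht).add ((h.deriv_snd t ht).const_mul r)).congr_deriv (by ring),
    fun t ht => (((h.deriv_snd t ht).const_mul r).sub (h.deriv_fst t ht)).congr_deriv (by ring)⟩

theorem of_isSaddleSolution_pos {y z : ℝ → ℝ} (hr : r ≠ 0)
    (h : IsSaddleSolution (fun t => b t - d * r) (fun t => b t + d * r) y z) :
    IsModeSolution b (d * r ^ 2) d (fun t => (y t + z t) / 2)
      (fun t => (y t - z t) / (2 * r)) :=
  ⟨(h.1.add h.2).div_const _, (h.1.sub h.2).div_const _,
    fun t ht => (((h.deriv_fst t ht).add (h.deriv_snd t ht)).div_const _).congr_deriv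
      (by field_simp; ring),
    fun t ht => (((h.deriv_fst t ht).sub (h.deriv_snd t ht)).div_const _).congr_deriv
      (by field_simp; ring)⟩

theorem of_isSaddleSolution_neg {y z : ℝ → ℝ} (hr : r ≠ 0)
    (h : IsSaddleSolution (fun t => -b t + d * r) (fun t => -b t - d * r) y z) :
    IsModeSolution b (d * r ^ 2) d (fun t => (y t - z t) / 2)
      (fun t => (y t + z t) / (2 * r)) :=
  ⟨(h.1.sub h.2).div_const _, (h.1.add h.2).div_const _,
    fun t ht => (((h.deriv_fst t ht).sub (h.deriv_snd t ht)).div_const _).congr_deriv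
      (by field_simp; ring),
    fun t ht => (((h.deriv_fst t ht).add (h.deriv_snd t ht)).div_const _).congr_deriv
      (by field_simp; ring)⟩

/-- The left side is (y² + z²)/2, which does not increase, so only the initial data must be
controlled by v(0) = (y + z)/2. Opposite signs of y and z might cancel there; the upper bound M
prevents this, because f/g ≤ (M - dr)/(M + dr) < 1 forces |y| below |z| by a fixed proportion. -/
theorem energy_le_of_pos {m M : ℝ} (hdr : 0 < d * r) (hm : 0 < m)
    (hb : ∀ t, 0 ≤ t → d * r + m ≤ b t) (hM : ∀ t, 0 ≤ t → b t ≤ M)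
    (h : IsModeSolution b (d * r ^ 2) d v η)
    (hyz : ∀ t, 0 ≤ t → (v t + r * η t) * (v t - r * η t) ≤ 0) (t : ℝ) (ht : 0 ≤ t) :
    v t ^ 2 + r ^ 2 * η t ^ 2 ≤ (2 * (M + d * r) / (d * r)) ^ 2 * v 0 ^ 2 := by
  have hs := h.isSaddleSolution_of_pos
  have hM0 : d * r + m ≤ M := (hb 0 le_rfl).trans (hM 0 le_rfl)
  have hMp : 0 < M + d * r := by linarith
  have h1 := hs.sq_fst_le (fun t ht => by linarith [hb t ht]) hyz t ht
  have h2 := hs.symm.sq_fst_le (fun t ht => by linarith [hb t ht])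
    (fun t ht => by rw [mul_comm]; exact hyz t ht) t ht
  have h3 := hs.sq_fst_le_mul_sq_snd hm (fun t ht => by linarith [hb t ht])
    (fun t ht => by linarith [hb t ht]) hyz (ϑ := (M - d * r) / (M + d * r))
    (div_nonneg (by linarith) hMp.le) (fun t ht => by
      rw [div_mul_eq_mul_div, le_div_iff₀ hMp]
      nlinarith [hM t ht])
  set y := v 0 + r * η 0
  set z := v 0 - r * η 0
  set s := d * r
  have h4 : (M + s) * y ^ 2 ≤ (M - s) * z ^ 2 := by
    rw [div_mul_eq_mul_div, le_div_iff₀ hMp] at h3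
    linarith
  have h5 : y ^ 2 ≤ z ^ 2 := by nlinarith [sq_nonneg y, sq_nonneg z]
  have h6 : s * |z| ≤ 2 * (M + s) * |v 0| := by
    have h7 : |y| ≤ |z| := sq_le_sq.1 h5
    have hv : v 0 = (y + z) / 2 := by simp [y, z]
    have h8 : |z| - |y| ≤ 2 * |v 0| := by
      have : |z| - |y| ≤ |z + y| := by simpa using abs_sub_abs_le_abs_sub z (-y)
      rw [hv, abs_div, add_comm y z]
      norm_num
      linarith
    rcases (abs_nonneg z).eq_or_lt with h0 | h0
    · rw [← h0]; simp; positivity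
    -- This is `h4` rearranged: (M + s)(z² - y²) ≥ 2s z². One factor |z| is then cancelled.
    · have h9 : 2 * s * |z| ^ 2 ≤ (M + s) * (|z| - |y|) * (|z| + |y|) := by
        have := sq_abs y
        have := sq_abs z
        nlinarith
      have h10 : (M + s) * (|z| - |y|) * (|z| + |y|) ≤ (M + s) * (2 * |v 0|) * (2 * |z|) := by
        gcongr
        linarith
      nlinarith
  have h11 : z ^ 2 ≤ (2 * (M + s) / s) ^ 2 * v 0 ^ 2 := by
    rw [← mul_pow, sq_le_sq, abs_mul, abs_of_pos (div_pos (by linarith) hdr : 0 < 2 * (M + s) / s),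
      div_mul_eq_mul_div, le_div_iff₀ hdr]
    linarith
  nlinarith

/-- Here yz ≤ 0 says r²η² ≤ v² outright, so no lower bound on b is needed. This is what makes the
estimate uniform along the unbounded high modes. -/
theorem energy_le_of_neg {m : ℝ} (hdr : 0 < d * r) (hm : 0 < m)
    (hb : ∀ t, 0 ≤ t → b t ≤ -(d * r + m)) (h : IsModeSolution b (d * r ^ 2) d v η)
    (hyz : ∀ t, 0 ≤ t → (v t + r * η t) * (r * η t - v t) ≤ 0) (t : ℝ) (ht : 0 ≤ t) :
    v t ^ 2 + r ^ 2 * η t ^ 2 ≤ 2 * v 0 ^ 2 := by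
  have hs := h.isSaddleSolution_of_neg
  have h1 := hs.sq_fst_le (fun t ht => by linarith [hb t ht]) hyz t ht
  have h2 := hs.symm.sq_fst_le (fun t ht => by linarith [hb t ht])
    (fun t ht => by rw [mul_comm]; exact hyz t ht) t ht
  nlinarith [hyz 0 le_rfl]

end IsModeSolution

theorem le_mul_of_energy_le {D r v₀ v η : ℝ} (hr : 0 < r)
    (h : v ^ 2 + r ^ 2 * η ^ 2 ≤ D ^ 2 * v₀ ^ 2) :
    |v| ≤ (|D| + |D| / r) * |v₀| ∧ |η| ≤ (|D| + |D| / r) * |v₀| := by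
  have h1 : |v| ≤ |D| * |v₀| := by
    rw [← abs_mul]
    exact sq_le_sq.1 (by rw [mul_pow]; nlinarith [mul_nonneg (sq_nonneg r) (sq_nonneg η)])
  have h2 : r * |η| ≤ |D| * |v₀| := by
    rw [← abs_mul, show r * |η| = |r * η| by rw [abs_mul, abs_of_pos hr]]
    exact sq_le_sq.1 (by rw [mul_pow, mul_pow]; nlinarith [sq_nonneg v])
  have h3 : |η| ≤ |D| / r * |v₀| := by
    rw [div_mul_eq_mul_div, le_div_iff₀ hr]; linarith
  have h4 : 0 ≤ |D| / r * |v₀| := by positivity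
  have h5 : 0 ≤ |D| * |v₀| := by positivity
  constructor <;> linarith

/-- A hyperbolic scalar Hamiltonian equation with `b` of constant sign has exactly one bounded
solution with `v 0 = 1`, and the bounded solutions are controlled by `v 0`, uniformly in `b`. -/
theorem exists_uniform_bound_isModeSolution {c d m M : ℝ} (hc : 0 < c) (hd : 0 < d)
    (hm : 0 < m) : ∃ C : ℝ, 0 ≤ C ∧ ∀ b : ℝ → ℝ, Continuous b →
      ((∀ t, 0 ≤ t → √(c * d) + m ≤ b t ∧ b t ≤ M) ∨
        (∀ t, 0 ≤ t → b t ≤ -(√(c * d) + m))) →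
      (∀ v η, IsModeSolution b c d v η → (∃ K, ∀ t, 0 ≤ t → |v t| ≤ K ∧ |η t| ≤ K) →
        ∀ t, 0 ≤ t → |v t| ≤ C * |v 0| ∧ |η t| ≤ C * |v 0|) ∧
      ∃ v η, IsModeSolution b c d v η ∧ v 0 = 1 ∧
        ∀ t, 0 ≤ t → |v t| ≤ C ∧ |η t| ≤ C := by
  set r := √(c / d) with hr_def
  have hr : 0 < r := Real.sqrt_pos.2 (div_pos hc hd)
  have hr2 : d * r ^ 2 = c := by rw [hr_def, Real.sq_sqrt (div_pos hc hd).le]; field_simp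
  have hσ : √(c * d) = d * r := by
    rw [← hr2, show d * r ^ 2 * d = (d * r) ^ 2 by ring, Real.sqrt_sq (by positivity)]
  have hdr : 0 < d * r := mul_pos hd hr
  -- One constant for both signs of b: D² dominates the factor of `energy_le_of_pos` and the factor
  -- 2 of `energy_le_of_neg`. The absolute value is there because M is arbitrary when b is negative.
  set D := |2 * (M + d * r) / (d * r)| + 2
  have hD : 0 ≤ D := by positivity
  have hD1 : (2 * (M + d * r) / (d * r)) ^ 2 ≤ D ^ 2 := sq_le_sq.2 (by
    rw [abs_of_nonneg hD]; simp only [D]; linarith)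
  have hD2 : (2 : ℝ) ≤ D ^ 2 := by
    have : 2 ≤ D := by simp [D]
    nlinarith
  refine ⟨|D| + |D| / r, by positivity, fun b hbc hb => ?_⟩
  rw [hσ] at hb
  have hscale : ∀ v η : ℝ → ℝ, IsModeSolution b c d v η → (v 0, η 0) ≠ 0 →
      (∀ t, 0 ≤ t → v t ^ 2 + r ^ 2 * η t ^ 2 ≤ D ^ 2 * v 0 ^ 2) →
      ∃ v η, IsModeSolution b c d v η ∧ v 0 = 1 ∧
        ∀ t, 0 ≤ t → |v t| ≤ |D| + |D| / r ∧ |η t| ≤ |D| + |D| / r := by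
    intro v η h h0 he
    -- If v(0) = 0, the energy bound at t = 0 kills η(0) as well; so a nontrivial stable solution
    -- can be normalized to v(0) = 1.
    have hv : v 0 ≠ 0 := fun hv => h0 (by
      have := he 0 le_rfl
      have : η 0 ^ 2 ≤ 0 := by
        rw [hv] at this
        have h3 : 0 < r ^ 2 := by positivity
        nlinarith
      have : η 0 = 0 := by nlinarith
      simp [hv, this])
    refine ⟨_, _, h.const_mul (v 0)⁻¹, inv_mul_cancel₀ hv, fun t ht => ?_⟩
    have := le_mul_of_energy_le hr (he t ht)
    simpa only [abs_mul, abs_inv, inv_mul_le_iff₀ (abs_pos.2 hv), mul_comm |v 0|] using this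
  have hbd : ∀ v η : ℝ → ℝ, (∃ K, ∀ t, 0 ≤ t → |v t| ≤ K ∧ |η t| ≤ K) →
      ∃ K, ∀ t, 0 ≤ t → |(v t + r * η t) * (v t - r * η t)| ≤ K := by
    rintro v η ⟨K, hK⟩
    refine ⟨(K + r * K) * (K + r * K), fun t ht => ?_⟩
    have hK0 : 0 ≤ K := (abs_nonneg _).trans (hK t ht).1
    have h1 : |r * η t| ≤ r * K := by
      rw [abs_mul, abs_of_pos hr]
      exact mul_le_mul_of_nonneg_left (hK t ht).2 hr.le
    rw [abs_mul]
    gcongr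
    · exact (abs_add_le _ _).trans (add_le_add (hK t ht).1 h1)
    · exact (abs_sub _ _).trans (add_le_add (hK t ht).1 h1)
  rw [← hr2] at hscale ⊢
  rcases hb with hb | hb
  · have hf : ∀ t, 0 ≤ t → m ≤ b t - d * r := fun t ht => by linarith [(hb t ht).1]
    have hg : ∀ t, 0 ≤ t → m ≤ b t + d * r := fun t ht => by linarith [hf t ht]
    have henergy : ∀ v η, IsModeSolution b (d * r ^ 2) d v η →
        (∀ t, 0 ≤ t → (v t + r * η t) * (v t - r * η t) ≤ 0) →
        ∀ t, 0 ≤ t → v t ^ 2 + r ^ 2 * η t ^ 2 ≤ D ^ 2 * v 0 ^ 2 := fun v η h hyz t ht =>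
      (h.energy_le_of_pos hdr hm (fun t ht => (hb t ht).1) (fun t ht => (hb t ht).2) hyz
        t ht).trans (mul_le_mul_of_nonneg_right hD1 (sq_nonneg _))
    refine ⟨fun v η h hK t ht => ?_, ?_⟩
    · obtain ⟨K, hK⟩ := hbd v η hK
      exact le_mul_of_energy_le hr (henergy v η h
        (h.isSaddleSolution_of_pos.mul_nonpos_of_bounded hm hf hg
          fun t ht => (le_abs_self _).trans (hK t ht)) t ht)
    · obtain ⟨y, z, h, h0, hyz⟩ := IsSaddleSolution.exists_mul_nonpos
        (f := fun t => b t - d * r) (g := fun t => b t + d * r) (by fun_prop) (by fun_prop)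
        (fun t ht => hm.le.trans (hf t ht)) (fun t ht => hm.le.trans (hg t ht))
      have h' := IsModeSolution.of_isSaddleSolution_pos hr.ne' h
      refine hscale _ _ h' (fun h00 => h0 ?_) (henergy _ _ h' fun t ht => ?_)
      · simp only [Prod.mk_eq_zero, div_eq_zero_iff, mul_eq_zero, hr.ne', OfNat.ofNat_ne_zero,
          or_false] at h00 ⊢
        constructor <;> linarith
      · refine le_of_eq_of_le ?_ (hyz t ht)
        field_simp
        ring
  · have hg : ∀ t, 0 ≤ t → m ≤ -b t - d * r := fun t ht => by linarith [hb t ht]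
    have hf : ∀ t, 0 ≤ t → m ≤ -b t + d * r := fun t ht => by linarith [hg t ht]
    have henergy : ∀ v η, IsModeSolution b (d * r ^ 2) d v η →
        (∀ t, 0 ≤ t → (v t + r * η t) * (r * η t - v t) ≤ 0) →
        ∀ t, 0 ≤ t → v t ^ 2 + r ^ 2 * η t ^ 2 ≤ D ^ 2 * v 0 ^ 2 := fun v η h hyz t ht =>
      (h.energy_le_of_neg hdr hm hb hyz t ht).trans
        (mul_le_mul_of_nonneg_right hD2 (sq_nonneg _))
    refine ⟨fun v η h hK t ht => ?_, ?_⟩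
    · obtain ⟨K, hK⟩ := hbd v η hK
      exact le_mul_of_energy_le hr (henergy v η h
        (h.isSaddleSolution_of_neg.mul_nonpos_of_bounded hm hf hg
          fun t ht => by
            have := (neg_le_abs _).trans (hK t ht)
            linarith) t ht)
    · obtain ⟨y, z, h, h0, hyz⟩ := IsSaddleSolution.exists_mul_nonpos
        (f := fun t => -b t + d * r) (g := fun t => -b t - d * r) (by fun_prop) (by fun_prop)
        (fun t ht => hm.le.trans (hf t ht)) (fun t ht => hm.le.trans (hg t ht))
      have h' := IsModeSolution.of_isSaddleSolution_neg hr.ne' h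
      refine hscale _ _ h' (fun h00 => h0 ?_) (henergy _ _ h' fun t ht => ?_)
      · simp only [Prod.mk_eq_zero, div_eq_zero_iff, mul_eq_zero, hr.ne', OfNat.ofNat_ne_zero,
          or_false] at h00 ⊢
        constructor <;> linarith
      · refine le_of_eq_of_le ?_ (hyz t ht)
        field_simp
        ring

namespace IsModeSolution

variable {b v η v' η' : ℝ → ℝ} {c d : ℝ}

theorem sub (h : IsModeSolution b c d v η) (h' : IsModeSolution b c d v' η') :
    IsModeSolution b c d (fun t => v t - v' t) (fun t => η t - η' t) :=
  ⟨h.1.sub h'.1, h.2.sub h'.2,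
    fun t ht => ((h.deriv_fst t ht).sub (h'.deriv_fst t ht)).congr_deriv (by ring),
    fun t ht => ((h.deriv_snd t ht).sub (h'.deriv_snd t ht)).congr_deriv (by ring)⟩

theorem congr (h : IsModeSolution b c d v η) (hv : ∀ t, 0 ≤ t → v' t = v t)
    (hη : ∀ t, 0 ≤ t → η' t = η t) : IsModeSolution b c d v' η' := by
  refine ⟨h.1.congr hv, h.2.congr hη, fun t ht => ?_, fun t ht => ?_⟩
  · rw [hv t ht.le, hη t ht.le]
    exact (h.deriv_fst t ht).congr_of_eventuallyEq
      (by filter_upwards [Ioi_mem_nhds ht] with s hs using hv s (le_of_lt hs))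
  · rw [hv t ht.le, hη t ht.le]
    exact (h.deriv_snd t ht).congr_of_eventuallyEq
      (by filter_upwards [Ioi_mem_nhds ht] with s hs using hη s (le_of_lt hs))

end IsModeSolution

/-! ### The scalar Cauchy formula -/

theorem hasDerivAt_of_cauchy_formula {β : ℝ} {v h : ℝ → ℝ} (hh : ContinuousOn h (Set.Ici 0))
    (hv : ∀ t, 0 ≤ t → v t = Real.exp (β * t) * v 0 +
      ∫ s in (0 : ℝ)..t, Real.exp (β * (t - s)) * h s) (t : ℝ) (ht : 0 < t) :
    HasDerivAt v (β * v t + h t) t := by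
  set w : ℝ → ℝ := fun s => Real.exp (-(β * s)) * h s
  have hexp : ∀ t s, Real.exp (β * (t - s)) * h s = Real.exp (β * t) * w s := fun t s => by
    rw [← mul_assoc, ← Real.exp_add]
    ring_nf
  have hv' : ∀ t, 0 ≤ t → v t = Real.exp (β * t) * (v 0 + ∫ s in (0 : ℝ)..t, w s) := by
    intro t ht
    rw [hv t ht, mul_add, ← intervalIntegral.integral_const_mul]
    simp only [hexp]
  have hw : ContinuousOn w (Set.Ici 0) := by fun_prop
  have hwt : ContinuousAt w t := hw.continuousAt (Ici_mem_nhds ht)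
  have hI : HasDerivAt (fun t => ∫ s in (0 : ℝ)..t, w s) (w t) t :=
    intervalIntegral.integral_hasDerivAt_right
      ((hw.mono (by rw [Set.uIcc_of_le ht.le]; exact Set.Icc_subset_Ici_self)).intervalIntegrable)
      (hw.mono Set.Ioi_subset_Ici_self |>.stronglyMeasurableAtFilter isOpen_Ioi t ht) hwt
  have hE : HasDerivAt (fun t => Real.exp (β * t)) (Real.exp (β * t) * (β * 1)) t :=
    ((hasDerivAt_id t).const_mul β).exp
  have h1 := hE.mul (hI.const_add (v 0))
  refine (h1.congr_deriv ?_).congr_of_eventuallyEq ?_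
  · rw [hv' t ht.le]
    have : Real.exp (β * t) * w t = h t := by rw [← hexp]; simp
    linear_combination this
  · filter_upwards [Ioi_mem_nhds ht] with s hs using hv' s (le_of_lt hs)

theorem cauchy_formula_of_hasDerivAt {β : ℝ} {v h : ℝ → ℝ} (hc : ContinuousOn v (Set.Ici 0))
    (hh : ContinuousOn h (Set.Ici 0)) (hd : ∀ t, 0 < t → HasDerivAt v (β * v t + h t) t)
    {s t : ℝ} (hs : 0 ≤ s) (hst : s ≤ t) :
    v t = Real.exp (β * (t - s)) * v s + ∫ r in s..t, Real.exp (β * (t - r)) * h r := by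
  have hsub : Set.Icc s t ⊆ Set.Ici 0 := fun r hr => hs.trans hr.1
  have key : ∫ r in s..t, Real.exp (β * (t - r)) * h r =
      Real.exp (β * (t - t)) * v t - Real.exp (β * (t - s)) * v s := by
    refine intervalIntegral.integral_eq_sub_of_hasDerivAt_of_le hst
      (f := fun r => Real.exp (β * (t - r)) * v r) ?_ (fun r hr => ?_) ?_
    · exact ContinuousOn.mul (by fun_prop) (hc.mono hsub)
    · have h1 : HasDerivAt (fun r => Real.exp (β * (t - r)))
          (Real.exp (β * (t - r)) * (β * (0 - 1))) r :=
        (((hasDerivAt_const r t).sub (hasDerivAt_id r)).const_mul β).exp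
      exact (h1.mul (hd r (hs.trans_lt hr.1))).congr_deriv (by ring)
    · refine ContinuousOn.intervalIntegrable ?_
      rw [Set.uIcc_of_le hst]
      exact ContinuousOn.mul (by fun_prop) (hh.mono hsub)
  rw [key]
  simp

/-! ### Diagonal operators -/

namespace HilbertBasis

variable {ι H : Type*} [NormedAddCommGroup H] [InnerProductSpace ℝ H] (e : HilbertBasis ι ℝ H)

theorem ext_inner {x y : H} (h : ∀ j, ⟪e j, x⟫_ℝ = ⟪e j, y⟫_ℝ) : x = y := by
  apply e.repr.injective
  ext j
  rw [e.repr_apply_apply, e.repr_apply_apply, h]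

theorem hasSum_sq_inner (x : H) : HasSum (fun j => ⟪e j, x⟫_ℝ ^ 2) (‖x‖ ^ 2) := by
  have h := e.hasSum_inner_mul_inner x x
  rw [real_inner_self_eq_norm_sq] at h
  exact h.congr_fun fun j => by rw [real_inner_comm x (e j), sq]

theorem norm_le_of_abs_inner_le {C : ℝ} (hC : 0 ≤ C) {x y : H}
    (h : ∀ j, |⟪e j, x⟫_ℝ| ≤ C * |⟪e j, y⟫_ℝ|) : ‖x‖ ≤ C * ‖y‖ := by
  refine abs_le_of_sq_le_sq' ?_ (by positivity) |>.2
  rw [mul_pow]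
  refine hasSum_le (fun j => ?_) (e.hasSum_sq_inner x) ((e.hasSum_sq_inner y).mul_left (C ^ 2))
  rw [← mul_pow, ← sq_abs, ← sq_abs (C * _), abs_mul, abs_of_nonneg hC]
  exact pow_le_pow_left₀ (abs_nonneg _) (h j) 2

/-- A bounded family of multipliers acts on `H`. -/
theorem exists_inner_eq_mul {C : ℝ} {p : ι → ℝ} (hp : ∀ j, |p j| ≤ C) (x : H) :
    ∃ y : H, (∀ j, ⟪e j, y⟫_ℝ = p j * ⟪e j, x⟫_ℝ) ∧
      HasSum (fun j => p j • ⟪e j, x⟫_ℝ • e j) y := by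
  have hmem : Memℓp (fun j => p j * ⟪e j, x⟫_ℝ) 2 := by
    rw [memℓp_gen_iff (by norm_num)]
    refine Summable.of_nonneg_of_le (fun j => by positivity) (fun j => ?_)
      ((e.hasSum_sq_inner x).summable.mul_left (C ^ 2))
    simp only [ENNReal.toReal_ofNat, Real.rpow_ofNat, norm_mul, Real.norm_eq_abs, mul_pow,
      sq_abs ⟪e j, x⟫_ℝ]
    gcongr
    exact hp j
  refine ⟨e.repr.symm ⟨_, hmem⟩, fun j => ?_, ?_⟩
  · rw [← e.repr_apply_apply, LinearIsometryEquiv.apply_symm_apply]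
  · convert e.hasSum_repr_symm ⟨_, hmem⟩ using 1
    ext j
    simp [mul_smul]

theorem exists_diagonal {C : ℝ} {p : ι → ℝ} (hC : 0 ≤ C) (hp : ∀ j, |p j| ≤ C) :
    ∃ T : H →L[ℝ] H, ∀ x j, ⟪e j, T x⟫_ℝ = p j * ⟪e j, x⟫_ℝ := by
  choose T hT _ using fun x => e.exists_inner_eq_mul hp x
  refine ⟨LinearMap.mkContinuous
    { toFun := T
      map_add' := fun x y => e.ext_inner fun j => by simp only [inner_add_right, hT, mul_add]
      map_smul' := fun a x => e.ext_inner fun j => by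
        simp only [inner_smul_right, hT, RingHom.id_apply]
        ring } C fun x => e.norm_le_of_abs_inner_le hC fun j => ?_, hT⟩
  simp only [LinearMap.coe_mk, AddHom.coe_mk, hT, abs_mul]
  exact mul_le_mul_of_nonneg_right (hp j) (abs_nonneg _)

theorem isSelfAdjoint_of_diagonal [CompleteSpace H] {p : ι → ℝ} {T : H →L[ℝ] H}
    (hT : ∀ x j, ⟪e j, T x⟫_ℝ = p j * ⟪e j, x⟫_ℝ) : IsSelfAdjoint T := by
  rw [ContinuousLinearMap.isSelfAdjoint_iff_isSymmetric]
  intro x y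
  simp only [ContinuousLinearMap.coe_coe]
  rw [← e.tsum_inner_mul_inner (T x) y, ← e.tsum_inner_mul_inner x (T y)]
  refine tsum_congr fun j => ?_
  rw [real_inner_comm, hT, hT, real_inner_comm]
  ring

/-- Dominated convergence for the coordinates. -/
theorem tendsto_of_tendsto_inner {X : Type*} {l : Filter X} {C : ℝ} {u : X → H} {x y : H}
    (hb : ∀ᶠ t in l, ∀ j, |⟪e j, u t⟫_ℝ| ≤ C * |⟪e j, y⟫_ℝ|)
    (hx : ∀ j, |⟪e j, x⟫_ℝ| ≤ C * |⟪e j, y⟫_ℝ|)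
    (hlim : ∀ j, Filter.Tendsto (fun t => ⟪e j, u t⟫_ℝ) l (nhds ⟪e j, x⟫_ℝ)) :
    Filter.Tendsto u l (nhds x) := by
  rw [tendsto_iff_norm_sub_tendsto_zero]
  have h1 : Filter.Tendsto (fun t => ∑' j, ⟪e j, u t - x⟫_ℝ ^ 2) l (nhds (∑' _ : ι, 0)) := by
    refine tendsto_tsum_of_dominated_convergence
      (bound := fun j => (2 * C) ^ 2 * ⟪e j, y⟫_ℝ ^ 2)
      ((e.hasSum_sq_inner y).summable.mul_left _) (fun j => ?_) ?_
    · have := ((hlim j).sub_const ⟪e j, x⟫_ℝ).pow 2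
      simpa [inner_sub_right] using this
    · filter_upwards [hb] with t ht j
      have h2 : |⟪e j, u t - x⟫_ℝ| ≤ 2 * C * |⟪e j, y⟫_ℝ| := by
        rw [inner_sub_right]
        have h3 := abs_sub ⟪e j, u t⟫_ℝ ⟪e j, x⟫_ℝ
        linarith [ht j, hx j]
      rw [norm_pow, Real.norm_eq_abs, ← sq_abs ⟪e j, y⟫_ℝ, ← mul_pow]
      exact pow_le_pow_left₀ (abs_nonneg _) h2 2
  have h2 : ∀ t, ∑' j, ⟪e j, u t - x⟫_ℝ ^ 2 = ‖u t - x‖ ^ 2 := fun t =>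
    (e.hasSum_sq_inner _).tsum_eq
  simp only [h2, tsum_zero] at h1
  have h3 := h1.sqrt
  simpa using h3

theorem continuousOn_of_inner {C : ℝ} {u : ℝ → H} {y : H} {s : Set ℝ}
    (hb : ∀ t ∈ s, ∀ j, |⟪e j, u t⟫_ℝ| ≤ C * |⟪e j, y⟫_ℝ|)
    (hc : ∀ j, ContinuousOn (fun t => ⟪e j, u t⟫_ℝ) s) : ContinuousOn u s := fun t ht =>
  e.tendsto_of_tendsto_inner (by filter_upwards [self_mem_nhdsWithin] with r hr using hb r hr)
    (hb t ht) fun j => hc j t ht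

end HilbertBasis

namespace SpatialAveraging

theorem IsEigenbasis.lam_pos {H : Type*} [NormedAddCommGroup H] [InnerProductSpace ℝ H]
    {A : H →ₗ.[ℝ] H} {e : HilbertBasis ℕ+ ℝ H} {lam : ℕ+ → ℝ} (h : IsEigenbasis A e lam)
    (hA : IsPositiveDefinite A) (j : ℕ+) : 0 < lam j := by
  obtain ⟨hj, hAj⟩ := h.2 j
  have h1 := hA ⟨e j, hj⟩ (e.orthonormal.ne_zero j)
  rw [hAj, inner_smul_left, real_inner_self_eq_norm_sq, e.orthonormal.1 j] at h1
  simpa using h1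

open Classical in
theorem inner_modeProj {H : Type*} [NormedAddCommGroup H] [InnerProductSpace ℝ H]
    [CompleteSpace H] (e : HilbertBasis ℕ+ ℝ H) (S : Set ℕ+) (v : H) (j : ℕ+) :
    ⟪e j, modeProj e S v⟫_ℝ = if j ∈ S then ⟪e j, v⟫_ℝ else 0 := by
  have h : ⟪e j, modeProj e S v⟫_ℝ = ⟪modeProj e S (e j), v⟫_ℝ :=
    (Submodule.inner_starProjection_left_eq_right _ _ _).symm
  split_ifs with hj
  · rw [h, modeProj_basis_mem e S hj]
  · rw [h, modeProj_basis_notMem e S hj, inner_zero_left]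

namespace Setting

variable {H Q : Type*} [NormedAddCommGroup H] [InnerProductSpace ℝ H] [CompleteSpace H]
  [MetricSpace Q] (S : Setting H Q)

/-! ### The semigroup -/

variable {S} in
theorem exp_mode_le (hpos : ∀ j, 0 < S.lam j) {t : ℝ} (ht : 0 ≤ t) (j : ℕ+) :
    |Real.exp ((S.α - S.lam j) * t)| ≤ Real.exp (|S.α| * t) := by
  rw [Real.abs_exp]
  gcongr
  linarith [hpos j, le_abs_self S.α]

variable {S} in
theorem inner_G (hpos : ∀ j, 0 < S.lam j) {t : ℝ} (ht : 0 ≤ t) (x : H) (j : ℕ+) :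
    ⟪S.e j, S.G t x⟫_ℝ = Real.exp ((S.α - S.lam j) * t) * ⟪S.e j, x⟫_ℝ := by
  obtain ⟨y, hy, hsum⟩ := S.e.exists_inner_eq_mul (exp_mode_le hpos ht) x
  rw [G, hsum.tsum_eq, hy]

variable {S} in
theorem norm_G_le (hpos : ∀ j, 0 < S.lam j) {t : ℝ} (ht : 0 ≤ t) (x : H) :
    ‖S.G t x‖ ≤ Real.exp (|S.α| * t) * ‖x‖ :=
  S.e.norm_le_of_abs_inner_le (Real.exp_pos _).le fun j => by
    rw [inner_G hpos ht, abs_mul]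
    exact mul_le_mul_of_nonneg_right (exp_mode_le hpos ht j) (abs_nonneg _)

-- Joint continuity from the splitting G(φ)w = G(φ)(w - w(t₀)) + G(φ)w(t₀): the first part is small
-- by the operator bound, the second converges mode by mode under a common majorant.
variable {S} in
theorem continuousOn_G (hpos : ∀ j, 0 < S.lam j) {s : Set ℝ} {φ : ℝ → ℝ} {w : ℝ → H}
    (hφ : ContinuousOn φ s) (hφ0 : ∀ t ∈ s, 0 ≤ φ t) (hw : ContinuousOn w s) :
    ContinuousOn (fun t => S.G (φ t) (w t)) s := by
  intro t₀ ht₀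
  have h1 : Filter.Tendsto (fun t => S.G (φ t) (w t - w t₀)) (nhdsWithin t₀ s) (nhds 0) := by
    refine squeeze_zero_norm' (a := fun t => Real.exp (|S.α| * φ t) * ‖w t - w t₀‖) ?_ ?_
    · filter_upwards [self_mem_nhdsWithin] with t ht using norm_G_le hpos (hφ0 t ht) _
    · have := ((hφ t₀ ht₀).tendsto.const_mul |S.α|).rexp.mul
        ((hw t₀ ht₀).tendsto.sub_const (w t₀)).norm
      simpa using this
  have h2 : Filter.Tendsto (fun t => S.G (φ t) (w t₀)) (nhdsWithin t₀ s)
      (nhds (S.G (φ t₀) (w t₀))) := by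
    have hb : ∀ t, 0 ≤ φ t → φ t ≤ φ t₀ + 1 → ∀ j, |⟪S.e j, S.G (φ t) (w t₀)⟫_ℝ| ≤
        Real.exp (|S.α| * (φ t₀ + 1)) * |⟪S.e j, w t₀⟫_ℝ| := fun t h0 h1 j => by
      rw [inner_G hpos h0, abs_mul]
      gcongr
      exact (exp_mode_le hpos h0 j).trans (by gcongr)
    refine S.e.tendsto_of_tendsto_inner ?_ (hb t₀ (hφ0 t₀ ht₀) (by simp)) fun j => ?_
    · filter_upwards [self_mem_nhdsWithin,
        (hφ t₀ ht₀).tendsto.eventually_le_const (lt_add_one (φ t₀))] with t ht ht'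
        using hb t (hφ0 t ht) ht'
    · rw [inner_G hpos (hφ0 t₀ ht₀)]
      refine Filter.Tendsto.congr' ?_
        ((((hφ t₀ ht₀).tendsto.const_mul (S.α - S.lam j)).rexp).mul_const ⟪S.e j, w t₀⟫_ℝ)
      filter_upwards [self_mem_nhdsWithin] with t ht
      rw [inner_G hpos (hφ0 t ht)]
  have h3 := h1.add h2
  rw [zero_add] at h3
  refine h3.congr' ?_
  filter_upwards [self_mem_nhdsWithin] with t ht
  refine S.e.ext_inner fun j => ?_
  rw [inner_add_right, inner_G hpos (hφ0 t ht), inner_G hpos (hφ0 t ht),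
    inner_G hpos (hφ0 t ht), inner_sub_right]
  ring

/-! ### The operators of the Hamiltonian system -/

/-- The projector on the modes that are not intermediate. -/
noncomputable def sideProj : H →L[ℝ] H := S.lowProj + S.highProj

theorem lowProj_add_highProj : S.lowProj + S.highProj = S.sideProj := rfl

/-- `j` is an intermediate mode. -/
def IsMid (j : ℕ+) : Prop :=
  S.lam S.N - (S.k : ℕ) ≤ S.lam j ∧ S.lam j ≤ S.lam (S.N + 1) + (S.k : ℕ)

open Classical in
variable {S} in
theorem inner_sideProj (hmono : Monotone S.lam) (x : H) (j : ℕ+) :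
    ⟪S.e j, S.sideProj x⟫_ℝ = if S.IsMid j then 0 else ⟪S.e j, x⟫_ℝ := by
  have hN : S.lam S.N ≤ S.lam (S.N + 1) := hmono (PNat.lt_add_right _ _).le
  have hk : (0 : ℝ) < (S.k : ℕ) := by exact_mod_cast S.k.pos
  rw [sideProj, add_apply, inner_add_right, lowProj, highProj,
    inner_modeProj, inner_modeProj]
  simp only [Set.mem_ofPred_eq, IsMid]
  grind

open Classical in
variable {S} in
theorem inner_midProj (hmono : Monotone S.lam) (x : H) (j : ℕ+) :
    ⟪S.e j, S.midProj x⟫_ℝ = if S.IsMid j then ⟪S.e j, x⟫_ℝ else 0 := by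
  have h : S.midProj x = x - S.sideProj x := by simp [midProj, sideProj, sub_sub]
  rw [h, inner_sub_right, inner_sideProj hmono]
  split_ifs <;> simp

variable {S} in
theorem isSelfAdjoint_midProj (hmono : Monotone S.lam) : IsSelfAdjoint S.midProj := by
  classical
  exact S.e.isSelfAdjoint_of_diagonal (p := fun j => if S.IsMid j then 1 else 0) fun x j => by
    rw [inner_midProj hmono]; simp

-- `F₃` multiplies by τ₁, τ₂ and τ₃ on three complementary subspaces, so inversion only inverts the
-- weights.
variable {S} in
theorem F₃inv_eq (hmono : Monotone S.lam) (h₁ : S.τ₁ ≠ 0) (h₂ : S.τ₂ ≠ 0) (h₃ : S.τ₃ ≠ 0) :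
    S.F₃inv = (WithLp.prodContinuousLinearEquiv 2 ℝ H H).symm.toContinuousLinearMap ∘L
      ((S.τ₁⁻¹ • S.midProj + S.τ₂⁻¹ • S.sideProj) ∘L WithLp.fstL 2 ℝ H H).prod
        (S.τ₃⁻¹ • WithLp.sndL 2 ℝ H H) := by
  classical
  refine ContinuousLinearMap.inverse_eq ?_ ?_
  all_goals
    ext x
    refine WithLp.ofLp_injective 2 (Prod.ext ?_ ?_)
    · refine S.e.ext_inner fun j => ?_
      simp [F₃, S.lowProj_add_highProj, inner_add_right, inner_smul_right, inner_midProj hmono,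
        inner_sideProj hmono]
      split_ifs <;> simp [h₁, h₂]
    · simp [F₃, h₃]

theorem B_adjoint_eq : S.B.adjoint =
    (WithLp.prodContinuousLinearEquiv 2 ℝ H H).symm.toContinuousLinearMap ∘L
      (ContinuousLinearMap.id ℝ H).prod (ContinuousLinearMap.id ℝ H) := by
  symm
  rw [ContinuousLinearMap.eq_adjoint_iff]
  intro x y
  simp [B, WithLp.prod_inner_apply, inner_add_right]

variable {S}

theorem B_F₃inv_F₂_apply (hmono : Monotone S.lam) (h₁ : S.τ₁ = 1) (h₂ : S.τ₂ ≠ 0)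
    (h₃ : S.τ₃ = 1) (q : Q) (x : H) : S.B (S.F₃inv (S.F₂ q x)) = -S.a q • S.midProj x := by
  classical
  refine S.e.ext_inner fun j => ?_
  rw [F₃inv_eq hmono (by simp [h₁]) h₂ (by simp [h₃])]
  simp [B, F₂, h₁, h₃, inner_add_right, inner_smul_right, inner_midProj hmono,
    inner_sideProj hmono]
  split_ifs <;> simp

/-- The feedback contributes a(q) on the intermediate modes and cancels the term -a(q) exactly
there. -/
theorem R₁₁_apply (hmono : Monotone S.lam) (h₁ : S.τ₁ = 1) (h₂ : S.τ₂ ≠ 0)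
    (h₃ : S.τ₃ = 1) (q : Q) (x : H) : S.R₁₁ q x = -S.a q • S.sideProj x := by
  simp only [R₁₁, sub_apply, neg_apply,
    ContinuousLinearMap.comp_apply, smul_apply,
    ContinuousLinearMap.id_apply, B_F₃inv_F₂_apply hmono h₁ h₂ h₃]
  simp [midProj, sideProj]
  module

theorem R₂₂_apply (hmono : Monotone S.lam) (h₁ : S.τ₁ = 1) (h₂ : S.τ₂ ≠ 0)
    (h₃ : S.τ₃ = 1) (q : Q) (x : H) : S.R₂₂ q x = S.a q • S.sideProj x := by
  have h : S.B ∘L S.F₃inv ∘L S.F₂ q = -S.a q • S.midProj := by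
    ext x
    exact B_F₃inv_F₂_apply hmono h₁ h₂ h₃ q x
  have hadj : (-S.a q • S.midProj).adjoint = -S.a q • S.midProj := by
    have hs := ContinuousLinearMap.isSelfAdjoint_iff_isSymmetric.1 (isSelfAdjoint_midProj hmono)
    simp only [LinearMap.IsSymmetric, ContinuousLinearMap.coe_coe] at hs
    symm
    rw [ContinuousLinearMap.eq_adjoint_iff]
    intro x y
    simp [inner_smul_left, inner_smul_right, hs]
  rw [R₂₂, h, hadj]
  simp [midProj, sideProj]
  module

theorem R₁₂_apply (hmono : Monotone S.lam) (h₁ : S.τ₁ = 1) (h₂ : S.τ₂ ≠ 0)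
    (h₃ : S.τ₃ = 1) (x : H) :
    S.R₁₂ x = (2 : ℝ) • S.midProj x + (S.τ₂⁻¹ + 1) • S.sideProj x := by
  rw [R₁₂, F₃inv_eq hmono (by simp [h₁]) h₂ (by simp [h₃]), B_adjoint_eq]
  simp [B, h₁, h₃]
  simp [midProj, sideProj]
  module

/-- The a(q)² term of `F₁` is removed by completing the square, so no dependence on q remains. -/
theorem R₂₁_apply (hmono : Monotone S.lam) (h₁ : S.τ₁ = 1) (h₂ : S.τ₂ ≠ 0)
    (h₃ : S.τ₃ = 1) (q : Q) (x : H) :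
    S.R₂₁ q x = -(S.δ ^ 2 + S.τ₂ * S.Lam ^ 2) • S.midProj x - S.Lam ^ 2 • S.sideProj x := by
  classical
  have hs := (ContinuousLinearMap.isSelfAdjoint_iff_isSymmetric.1 (isSelfAdjoint_midProj hmono))
  simp only [LinearMap.IsSymmetric, ContinuousLinearMap.coe_coe] at hs
  refine S.e.ext_inner fun j => ?_
  rw [R₂₁, sub_apply, inner_sub_right, ContinuousLinearMap.comp_apply,
    ContinuousLinearMap.adjoint_inner_right, F₃inv_eq hmono (by simp [h₁]) h₂ (by simp [h₃])]
  simp [F₁, F₂, h₁, h₃, S.lowProj_add_highProj, WithLp.prod_inner_apply, inner_add_right, inner_sub_right,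
    inner_smul_right, inner_smul_left, hs, inner_midProj hmono, inner_sideProj hmono]
  split_ifs <;> simp
  ring

variable (S)

/-! ### Decoupling over the eigenbasis -/

open Classical in
/-- The diagonal coefficient of the Hamiltonian system in the mode `j`. -/
noncomputable def modeB (q : Q) (j : ℕ+) (t : ℝ) : ℝ :=
  S.α - S.lam j - if S.IsMid j then 0 else S.a (S.shift t q)

open Classical in
noncomputable def modeC (j : ℕ+) : ℝ := if S.IsMid j then 2 else S.τ₂⁻¹ + 1

open Classical in
noncomputable def modeD (j : ℕ+) : ℝ :=
  if S.IsMid j then S.δ ^ 2 + S.τ₂ * S.Lam ^ 2 else S.Lam ^ 2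

variable {S}

theorem continuous_a_shift (ha : Continuous S.a) (q : Q) :
    Continuous fun t => S.a (S.shift t q) :=
  ha.comp (S.θ.continuous continuous_real_toNNReal continuous_const)

theorem continuous_modeB (ha : Continuous S.a) (q : Q) (j : ℕ+) :
    Continuous (S.modeB q j) := by
  unfold modeB
  split_ifs
  · exact continuous_const
  · exact continuous_const.sub (continuous_a_shift ha q)

section Inner

variable (hmono : Monotone S.lam) (h₁ : S.τ₁ = 1) (h₂ : S.τ₂ ≠ 0) (h₃ : S.τ₃ = 1)
include hmono h₁ h₂ h₃

theorem inner_R₁ (q : Q) (x y : H) (j : ℕ+) (t : ℝ) :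
    ⟪S.e j, S.R₁₁ (S.shift t q) x + S.R₁₂ y⟫_ℝ =
      (S.modeB q j t - (S.α - S.lam j)) * ⟪S.e j, x⟫_ℝ + S.modeC j * ⟪S.e j, y⟫_ℝ := by
  classical
  simp only [R₁₁_apply hmono h₁ h₂ h₃, R₁₂_apply hmono h₁ h₂ h₃, inner_add_right,
    inner_smul_right, inner_midProj hmono, inner_sideProj hmono, modeB, modeC]
  split_ifs <;> ring

theorem inner_R₂ (q : Q) (x y : H) (j : ℕ+) (t : ℝ) :
    ⟪S.e j, S.R₂₁ (S.shift t q) x + S.R₂₂ (S.shift t q) y⟫_ℝ =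
      -S.modeD j * ⟪S.e j, x⟫_ℝ - (S.modeB q j t - (S.α - S.lam j)) * ⟪S.e j, y⟫_ℝ := by
  classical
  simp only [R₂₁_apply hmono h₁ h₂ h₃, R₂₂_apply hmono h₁ h₂ h₃, inner_add_right,
    inner_sub_right, inner_smul_right, inner_midProj hmono, inner_sideProj hmono, modeB, modeD]
  split_ifs <;> ring

variable (ha : Continuous S.a) {v η : ℝ → H} (hv : ContinuousOn v (Set.Ici 0))
  (hη : ContinuousOn η (Set.Ici 0))
include ha hv hη

theorem continuousOn_R₁ (q : Q) :
    ContinuousOn (fun s => S.R₁₁ (S.shift s q) (v s) + S.R₁₂ (η s)) (Set.Ici 0) := by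
  simp only [R₁₁_apply hmono h₁ h₂ h₃]
  exact ((continuous_a_shift ha q).neg.continuousOn.smul
    (S.sideProj.continuous.comp_continuousOn hv)).add (S.R₁₂.continuous.comp_continuousOn hη)

theorem continuousOn_R₂ (q : Q) : ContinuousOn
    (fun s => S.R₂₁ (S.shift s q) (v s) + S.R₂₂ (S.shift s q) (η s)) (Set.Ici 0) := by
  simp only [R₂₁_apply hmono h₁ h₂ h₃, R₂₂_apply hmono h₁ h₂ h₃]
  exact (((S.midProj.continuous.comp_continuousOn hv).const_smul _).sub
    ((S.sideProj.continuous.comp_continuousOn hv).const_smul _)).add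
    ((continuous_a_shift ha q).continuousOn.smul (S.sideProj.continuous.comp_continuousOn hη))

end Inner

theorem inner_integral_G (hpos : ∀ j, 0 < S.lam j) {w : ℝ → H} {φ : ℝ → ℝ} {s t : ℝ}
    (hs : 0 ≤ s) (hst : s ≤ t) (hφ : Continuous φ) (hφ0 : ∀ r ∈ Set.Icc s t, 0 ≤ φ r)
    (hw : ContinuousOn w (Set.Ici 0)) (j : ℕ+) :
    ⟪S.e j, ∫ r in s..t, S.G (φ r) (w r)⟫_ℝ =
      ∫ r in s..t, Real.exp ((S.α - S.lam j) * φ r) * ⟪S.e j, w r⟫_ℝ := by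
  have hint : IntervalIntegrable (fun r => S.G (φ r) (w r)) volume s t := by
    refine ContinuousOn.intervalIntegrable ?_
    rw [Set.uIcc_of_le hst]
    exact continuousOn_G hpos hφ.continuousOn hφ0 (hw.mono fun r hr => hs.trans hr.1)
  rw [← innerSL_apply_apply ℝ, ← (innerSL ℝ (S.e j)).intervalIntegral_comp_comm hint]
  refine intervalIntegral.integral_congr fun r hr => ?_
  rw [Set.uIcc_of_le hst] at hr
  rw [innerSL_apply_apply, inner_G hpos (hφ0 r hr)]

/-- Vectors are determined by their coordinates, and in a single mode the semigroup is an invertible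
exponential, so both Cauchy formulas are equivalent to ordinary differential equations. -/
theorem isMildSolution_iff (hmono : Monotone S.lam) (h₁ : S.τ₁ = 1) (h₂ : S.τ₂ ≠ 0)
    (h₃ : S.τ₃ = 1) (hpos : ∀ j, 0 < S.lam j) (ha : Continuous S.a) {q : Q} {v η : ℝ → H}
    (hv : ContinuousOn v (Set.Ici 0)) (hη : ContinuousOn η (Set.Ici 0)) :
    S.IsMildSolution q v η ↔ ∀ j, IsModeSolution (S.modeB q j) (S.modeC j) (S.modeD j)
      (fun t => ⟪S.e j, v t⟫_ℝ) (fun t => ⟪S.e j, η t⟫_ℝ) := by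
  have hw₁ := continuousOn_R₁ hmono h₁ h₂ h₃ ha hv hη q
  have hw₂ := continuousOn_R₂ hmono h₁ h₂ h₃ ha hv hη q
  have hc : ∀ (j : ℕ+) {w : ℝ → H}, ContinuousOn w (Set.Ici 0) →
      ContinuousOn (fun t => ⟪S.e j, w t⟫_ℝ) (Set.Ici 0) := fun j w hw =>
    continuousOn_const.inner hw
  constructor
  · rintro ⟨-, -, hmv, hmη⟩ j
    refine ⟨hc j hv, hc j hη, fun t ht => ?_, fun t ht => ?_⟩
    · have h := hasDerivAt_of_cauchy_formula (β := S.α - S.lam j)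
        (v := fun t => ⟪S.e j, v t⟫_ℝ) (hc j hw₁) (fun t ht => by
          have h := congrArg (fun x => ⟪S.e j, x⟫_ℝ) (hmv t ht)
          simp only [inner_add_right (S.e j) (S.G _ _)] at h
          rw [h, inner_G hpos ht, inner_integral_G hpos le_rfl ht (by fun_prop)
            (fun r hr => sub_nonneg.2 hr.2) hw₁]) t ht
      refine h.congr_deriv ?_
      rw [inner_R₁ hmono h₁ h₂ h₃]
      ring
    -- The backward formula with s = 0 is solved for η(t), which turns it into a forward formula
    -- with the opposite exponent.
    · have h := hasDerivAt_of_cauchy_formula (β := -(S.α - S.lam j))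
        (v := fun t => ⟪S.e j, η t⟫_ℝ) (hc j hw₂) (fun t ht => by
          have h := congrArg (fun x => ⟪S.e j, x⟫_ℝ) (hmη 0 t le_rfl ht)
          simp only [inner_sub_right (S.e j) (S.G _ _), sub_zero] at h
          rw [inner_G hpos ht, inner_integral_G (φ := fun r => r) hpos le_rfl ht continuous_id
            (fun r hr => hr.1) hw₂] at h
          have he : ∀ s w, Real.exp (-(S.α - S.lam j) * (t - s)) * w =
              Real.exp (-(S.α - S.lam j) * t) * (Real.exp ((S.α - S.lam j) * s) * w) :=
            fun s w => by
              rw [← mul_assoc, ← Real.exp_add]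
              ring_nf
          simp only [he]
          rw [intervalIntegral.integral_const_mul, ← mul_add, h, sub_add_cancel,
            ← mul_assoc, ← Real.exp_add, neg_mul, neg_add_cancel, Real.exp_zero, one_mul]) t ht
      refine h.congr_deriv ?_
      rw [inner_R₂ hmono h₁ h₂ h₃]
      ring
  · intro hmode
    refine ⟨hv, hη, fun t ht => S.e.ext_inner fun j => ?_,
      fun s t hs hst => S.e.ext_inner fun j => ?_⟩
    · rw [inner_add_right (S.e j), inner_G hpos ht, inner_integral_G hpos le_rfl ht (by fun_prop)
        (fun r hr => sub_nonneg.2 hr.2) hw₁]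
      have h := cauchy_formula_of_hasDerivAt (β := S.α - S.lam j) (hc j hv) (hc j hw₁)
        (fun t ht => ((hmode j).deriv_fst t ht).congr_deriv (by
          rw [inner_R₁ hmono h₁ h₂ h₃]; ring)) le_rfl ht
      simpa using h
    · rw [inner_sub_right (S.e j), inner_G hpos (sub_nonneg.2 hst),
        inner_integral_G hpos hs hst (by fun_prop) (fun r hr => sub_nonneg.2 hr.1) hw₂]
      have h := cauchy_formula_of_hasDerivAt (β := -(S.α - S.lam j)) (hc j hη) (hc j hw₂)
        (fun t ht => ((hmode j).deriv_snd t ht).congr_deriv (by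
          rw [inner_R₂ hmono h₁ h₂ h₃]; ring)) hs hst
      have he : ∀ r w, Real.exp ((S.α - S.lam j) * (r - s)) * w =
          Real.exp ((S.α - S.lam j) * (t - s)) *
            (Real.exp (-(S.α - S.lam j) * (t - r)) * w) := fun r w => by
        rw [← mul_assoc, ← Real.exp_add]
        ring_nf
      simp only [he _ ⟪S.e j, _ + _⟫_ℝ]
      rw [intervalIntegral.integral_const_mul, h, mul_add, add_sub_cancel_right, ← mul_assoc,
        ← Real.exp_add, neg_mul, add_neg_cancel, Real.exp_zero, one_mul]

/-! ### Hyperbolicity of the modes -/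

theorem exists_uniform_mode_bound (hmono : Monotone S.lam) (hpos : ∀ j, 0 < S.lam j)
    (ha : Continuous S.a) (hLam : 0 < S.Lam) (hδ : 0 < S.δ)
    (ha_bound : ∀ q, |S.a q| ≤ S.Lam + S.δ)
    (hτ₂ : S.τ₂ = (1 / 4) * (S.μ / S.Lam) ^ 2) (hμ : 0 < S.μ)
    (h_gap : 0 ≤ S.μ / Real.sqrt 5 - S.δ)
    (h_k : 0 ≤ ((S.k : ℕ) : ℝ) ^ 2 - 2 * S.Lam * ((S.k : ℕ) : ℝ)
      - 4 * (S.Lam ^ 4 / S.μ ^ 2)) :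
    ∃ C : ℝ, 0 ≤ C ∧ ∀ q j,
      (∀ v η, IsModeSolution (S.modeB q j) (S.modeC j) (S.modeD j) v η →
        (∃ K, ∀ t, 0 ≤ t → |v t| ≤ K ∧ |η t| ≤ K) →
        ∀ t, 0 ≤ t → |v t| ≤ C * |v 0| ∧ |η t| ≤ C * |v 0|) ∧
      ∃ v η, IsModeSolution (S.modeB q j) (S.modeC j) (S.modeD j) v η ∧ v 0 = 1 ∧
        ∀ t, 0 ≤ t → |v t| ≤ C ∧ |η t| ≤ C := by
  have h5 : (0 : ℝ) < √5 := by positivity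
  have hδμ : 5 * S.δ ^ 2 ≤ S.μ ^ 2 := by
    have h : S.δ * √5 ≤ S.μ := (le_div_iff₀ h5).1 (sub_nonneg.1 h_gap)
    have h' := pow_le_pow_left₀ (by positivity) h 2
    rw [mul_pow, Real.sq_sqrt (by norm_num)] at h'
    linarith
  have hδμ' : S.δ < S.μ := by nlinarith
  have hτ₂pos : 0 < S.τ₂ := by rw [hτ₂]; positivity
  have hτΛ : S.τ₂ * S.Lam ^ 2 = S.μ ^ 2 / 4 := by rw [hτ₂]; field_simp
  have hk : (0 : ℝ) < (S.k : ℕ) := by exact_mod_cast S.k.pos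
  set k : ℝ := ((S.k : ℕ) : ℝ)
  have hΛk : 2 * S.Lam ≤ k := by
    have : 0 ≤ 4 * (S.Lam ^ 4 / S.μ ^ 2) := by positivity
    nlinarith
  have hα₁ : S.α = S.lam S.N + S.μ := by simp only [α, μ]; ring
  have hα₂ : S.α = S.lam (S.N + 1) - S.μ := by simp only [α, μ]; ring
  -- Since δ² ≤ μ²/5 and τ₂Λ² = μ²/4, the radicand is at most 0.9 μ² < (0.98 μ)²; hence the margin
  -- μ/50.
  have hσ₁ : √(2 * (S.δ ^ 2 + S.τ₂ * S.Lam ^ 2)) + S.μ / 50 ≤ S.μ := by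
    rw [hτΛ, ← le_sub_iff_add_le]
    refine Real.sqrt_le_iff.2 ⟨by linarith, ?_⟩
    nlinarith
  -- After squaring this is precisely `h_k`. On the other modes |b| ≥ μ + k - (Λ + δ), which leaves
  -- the margin μ - δ.
  have hσ₂ : √((S.τ₂⁻¹ + 1) * S.Lam ^ 2) ≤ k - S.Lam := by
    refine Real.sqrt_le_iff.2 ⟨by linarith, ?_⟩
    have h : (S.τ₂⁻¹ + 1) * S.Lam ^ 2 = 4 * (S.Lam ^ 4 / S.μ ^ 2) + S.Lam ^ 2 := by
      rw [hτ₂]; field_simp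
    rw [h]
    nlinarith
  obtain ⟨C₁, hC₁, H₁⟩ := exists_uniform_bound_isModeSolution (c := 2)
    (d := S.δ ^ 2 + S.τ₂ * S.Lam ^ 2) (m := S.μ / 50) (M := S.α) (by norm_num)
    (by positivity) (by positivity)
  obtain ⟨C₂, hC₂, H₂⟩ := exists_uniform_bound_isModeSolution (c := S.τ₂⁻¹ + 1)
    (d := S.Lam ^ 2) (m := S.μ - S.δ) (M := S.α + S.Lam + S.δ) (by positivity)
    (by positivity) (sub_pos.2 hδμ')
  have hmode : ∀ q j, ∃ C : ℝ, 0 ≤ C ∧ C ≤ C₁ + C₂ ∧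
      (∀ v η, IsModeSolution (S.modeB q j) (S.modeC j) (S.modeD j) v η →
        (∃ K, ∀ t, 0 ≤ t → |v t| ≤ K ∧ |η t| ≤ K) →
        ∀ t, 0 ≤ t → |v t| ≤ C * |v 0| ∧ |η t| ≤ C * |v 0|) ∧
      ∃ v η, IsModeSolution (S.modeB q j) (S.modeC j) (S.modeD j) v η ∧ v 0 = 1 ∧
        ∀ t, 0 ≤ t → |v t| ≤ C ∧ |η t| ≤ C := by
    intro q j
    by_cases hj : S.IsMid j
    · refine ⟨C₁, hC₁, by linarith, ?_⟩
      simp only [modeC, modeD, if_pos hj]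
      refine H₁ _ (continuous_modeB ha q j) ?_
      simp only [modeB, if_pos hj, sub_zero]
      -- The spectral gap lies between N and N + 1, and α is its midpoint, so |α - λ_j| ≥ μ on
      -- either side.
      rcases le_or_gt j S.N with hjN | hjN
      · left
        intro t _
        constructor <;> linarith [hmono hjN, hpos j]
      · right
        intro t _
        linarith [hmono (PNat.add_one_le_iff.2 hjN)]
    · refine ⟨C₂, hC₂, by linarith, ?_⟩
      simp only [modeC, modeD, if_neg hj]
      refine H₂ _ (continuous_modeB ha q j) ?_
      simp only [modeB, if_neg hj]
      have hab : ∀ t, _ := fun t => abs_le.1 (ha_bound (S.shift t q))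
      rw [IsMid, not_and_or, not_le, not_le] at hj
      rcases hj with hj | hj
      · left
        intro t _
        constructor <;> linarith [hab t, (hab t).1, (hab t).2, hpos j]
      · right
        intro t _
        linarith [(hab t).1]
  refine ⟨C₁ + C₂, by positivity, fun q j => ?_⟩
  obtain ⟨C, hC0, hC, hb, v, η, h, hv0, hvη⟩ := hmode q j
  refine ⟨fun v η h hK t ht => ?_, v, η, h, hv0, fun t ht =>
    ⟨(hvη t ht).1.trans hC, (hvη t ht).2.trans hC⟩⟩
  have hle := mul_le_mul_of_nonneg_right hC (abs_nonneg (v 0))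
  exact ⟨(hb v η h hK t ht).1.trans hle, (hb v η h hK t ht).2.trans hle⟩

end Setting

end SpatialAveraging

/-! ### Assembling the modes into a graph -/

theorem mainTheorem9 {H Q : Type*} [NormedAddCommGroup H] [InnerProductSpace ℝ H]
    [CompleteSpace H] [MetricSpace Q] [CompleteSpace Q]
    (A₀ : H →ₗ.[ℝ] H) (S : SpatialAveraging.Setting H Q)
    (hA₀_selfAdjoint : IsSelfAdjoint A₀)
    (hA₀_pos : SpatialAveraging.IsPositiveDefinite A₀)
    (hA₀_compact : SpatialAveraging.HasCompactResolvent A₀)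
    (h_eigen : SpatialAveraging.IsEigenbasis A₀ S.e S.lam)
    (ha_cont : Continuous S.a)
    (hLam : 0 < S.Lam) (hδ : 0 < S.δ)
    (ha_bound : ∀ q, |S.a q| ≤ S.Lam + S.δ)
    (hτ₁ : S.τ₁ = 1) (hτ₂ : S.τ₂ = (1 / 4) * (S.μ / S.Lam) ^ 2) (hτ₃ : S.τ₃ = 1)
    (h_gap : 0 ≤ S.μ / Real.sqrt 5 - S.δ)
    (h_k : 0 ≤ ((S.k : ℕ) : ℝ) ^ 2 - 2 * S.Lam * ((S.k : ℕ) : ℝ) - 4 * (S.Lam ^ 4 / S.μ ^ 2))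
    (h_unique : ∀ q, ∃! p : SpatialAveraging.Setting.PairSpace H, S.IsCriticalPoint q p) :
    S.IsNonoscillating := by
  have hmono := h_eigen.1
  have hpos := h_eigen.lam_pos hA₀_pos
  have hμ : 0 < S.μ := (div_pos_iff_of_pos_right (by positivity : (0 : ℝ) < √5)).1 (by linarith)
  have hτ₂' : S.τ₂ ≠ 0 := by rw [hτ₂]; positivity
  have hmild := fun q v η => S.isMildSolution_iff hmono hτ₁ hτ₂' hτ₃ hpos ha_cont
    (q := q) (v := v) (η := η)
  obtain ⟨C, hC, hmode⟩ := SpatialAveraging.Setting.exists_uniform_mode_bound hmono hpos ha_cont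
    hLam hδ ha_bound hτ₂ hμ h_gap h_k
  choose φ ψ hsol hφ0 hbd using fun q j => (hmode q j).2
  have hP := fun q => S.e.exists_diagonal (p := fun j => -ψ q j 0) hC fun j => by
    rw [abs_neg]; exact (hbd q j 0 le_rfl).2
  choose P hP using hP
  refine ⟨P, fun q => S.e.isSelfAdjoint_of_diagonal (hP q), fun q => Set.ext fun z => ?_⟩
  constructor
  · rintro ⟨v, η, h, rfl, K, hK⟩
    refine ⟨v 0, Prod.ext rfl (S.e.ext_inner fun j => ?_)⟩
    have h' := (hmild q v η h.1 h.2.1).1 h j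
    -- The difference is a bounded solution of the mode with vanishing first component at 0, so the
    -- estimate by |v(0)| makes it zero.
    have hd := h'.sub ((hsol q j).const_mul ⟪S.e j, v 0⟫_ℝ)
    have hnorm : ∀ x : H, |⟪S.e j, x⟫_ℝ| ≤ ‖x‖ := fun x => by
      simpa [S.e.orthonormal.1 j] using abs_real_inner_le_norm (S.e j) x
    have h0 := ((hmode q j).1 _ _ hd ⟨K + |⟪S.e j, v 0⟫_ℝ| * C, fun t ht => ⟨?_, ?_⟩⟩ 0 le_rfl).2
    · simp only [hφ0, mul_one, sub_self, abs_zero, mul_zero, abs_nonpos_iff] at h0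
      rw [inner_neg_right, hP]
      linarith
    · refine (abs_sub _ _).trans (add_le_add ((hnorm _).trans (hK t ht).1) ?_)
      rw [abs_mul]
      exact mul_le_mul_of_nonneg_left (hbd q j t ht).1 (abs_nonneg _)
    · refine (abs_sub _ _).trans (add_le_add ((hnorm _).trans (hK t ht).2) ?_)
      rw [abs_mul]
      exact mul_le_mul_of_nonneg_left (hbd q j t ht).2 (abs_nonneg _)
  · rintro ⟨x, rfl⟩
    -- Synthesis from coordinates: the common bound C provides both the convergence of the expansion
    -- and the majorant behind continuity in t.
    have hex : ∀ f : ℕ+ → ℝ → ℝ, (∀ j, ContinuousOn (f j) (Set.Ici 0)) →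
        (∀ j t, 0 ≤ t → |f j t| ≤ C) → ∃ u : ℝ → H, ContinuousOn u (Set.Ici 0) ∧
          (∀ t, 0 ≤ t → ‖u t‖ ≤ C * ‖x‖) ∧
          ∀ j t, 0 ≤ t → ⟪S.e j, u t⟫_ℝ = ⟪S.e j, x⟫_ℝ * f j t := by
      intro f hf hfC
      have hu : ∀ t : ℝ, ∃ y : H, 0 ≤ t → ∀ j, ⟪S.e j, y⟫_ℝ = ⟪S.e j, x⟫_ℝ * f j t := by
        intro t
        by_cases ht : 0 ≤ t
        · obtain ⟨y, hy, -⟩ := S.e.exists_inner_eq_mul (fun j => hfC j t ht) x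
          exact ⟨y, fun _ j => by rw [hy, mul_comm]⟩
        · exact ⟨0, fun h => absurd h ht⟩
      choose u hu using hu
      have hb : ∀ t, 0 ≤ t → ∀ j, |⟪S.e j, u t⟫_ℝ| ≤ C * |⟪S.e j, x⟫_ℝ| := fun t ht j => by
        rw [hu t ht, abs_mul, mul_comm]
        exact mul_le_mul_of_nonneg_right (hfC j t ht) (abs_nonneg _)
      refine ⟨u, S.e.continuousOn_of_inner hb fun j => ?_,
        fun t ht => S.e.norm_le_of_abs_inner_le hC (hb t ht), fun j t ht => hu t ht j⟩
      exact (continuousOn_const.mul (hf j)).congr fun t ht => hu t ht j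
    obtain ⟨v, hvc, hvC, hv⟩ := hex (φ q) (fun j => (hsol q j).1) fun j t ht => (hbd q j t ht).1
    obtain ⟨η, hηc, hηC, hη⟩ := hex (ψ q) (fun j => (hsol q j).2) fun j t ht => (hbd q j t ht).2
    refine ⟨v, η, (hmild q v η hvc hηc).2 fun j => ((hsol q j).const_mul ⟪S.e j, x⟫_ℝ).congr
      (fun t ht => hv j t ht) (fun t ht => hη j t ht), Prod.ext (S.e.ext_inner fun j => ?_)
      (S.e.ext_inner fun j => ?_), C * ‖x‖, fun t ht => ⟨hvC t ht, hηC t ht⟩⟩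
    · rw [hv j 0 le_rfl, hφ0, mul_one]
    · rw [hη j 0 le_rfl, inner_neg_right, hP]
      ring
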